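/- Let $D\subset\mathbb R^d$, $d\ge 1$, be a nonempty open set (for instance a bounded Lipschitz domain with $d\in\{1,2,3\}$) and $H=L^2(D)$, with Hilbert–Schmidt norm $\|\cdot\|_{\mathcal L_2(H)}$ for operators on $H$. Let $\gamma\in(1/2,1)$ and $T>0$. Then there are an orthonormal basis $(e_k)_{k\ge1}$ of $H$ and the operators $$A=\sum_{k\ge1}\lambda_k\langle e_k,\cdot\rangle e_k,\quad Q=\sum_{k\ge1}\mu_k\langle e_k,\cdot\rangle e_k,\qquad \lambda_k=k^2,\quad \mu_1=0,\quad \mu_k=\frac{1}{k^{\gamma+1/2}\log k}\ (k\ge2),$$ where $A$ has its natural domain, with the following properties. (i) $A$ is closed, densely defined, self-adjoint, positive definite and has a compact inverse; $Q$ is symmetric, positive semidefinite and of trace class; and $\|A^{\gamma/2}Q\|_{\mathcal L_2(H)}<\infty$. (ii) There is a constant $C>0$ such that the following holds. Let $W$ be a $Q$-Wiener process on a filtered probability space $(\Omega,\mathcal F,(\mathcal F_t)_{t\ge0},P)$, let $X_0\in L^4(\Omega,H)$ be $\mathcal F_0$-measurable with $E\|A^{\iota/2}X_0\|^4<\infty$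 for some $\iota\ge\gamma/2$ (for instance $X_0=0$), and let $$X_t=S(t)X_0+\int_0^tS(t-s)\,dW_s,\qquad t\ge0,$$ be the mild solution of $dX_t+AX_t\,dt=dW_t$, where $S$ is the strongly continuous semigroup generated by $-A$. Put $$RV_T^{\Delta,I}=\sum_{i=1}^{\lfloor T/\Delta\rfloor}(X_{i\Delta}-X_{(i-1)\Delta})^{\otimes2},\qquad f^{\otimes 2}=\langle f,\cdot\rangle f.$$ Then, for all sufficiently small $\Delta>0$, $RV_T^{\Delta,I}$ is integrable and $$\left(E\left\|\frac{RV_T^{\Delta,I}}{T}-Q\right\|_{\mathcal L_2(H)}^2\right)^{1/2}\ \ge\ \left\|E\left[\frac{RV_T^{\Delta,I}}{T}\right]-Q\right\|_{\mathcal L_2(H)}\ \ge\ C\,\frac{\Delta^{\gamma/2}}{|\log\Delta|}.$$ -/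

import Mathlib

open MeasureTheory ProbabilityTheory Filter Topology
open scoped ENNReal NNReal RealInnerProductSpace

namespace RealizedCovariation

noncomputable section

section Operators

variable {H : Type*} [NormedAddCommGroup H] [InnerProductSpace ℝ H] [CompleteSpace H]

/-! ### Hilbert-Schmidt norm and trace class covariances -/

/-- A fixed orthonormal basis of `H`, used to write down the Hilbert-Schmidt norm. -/
def onb (H : Type*) [NormedAddCommGroup H] [InnerProductSpace ℝ H] [CompleteSpace H] :
    HilbertBasis (exists_hilbertBasis ℝ H).choose ℝ H :=
  (exists_hilbertBasis ℝ H).choose_spec.choose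

/-- The Hilbert-Schmidt norm `(∑ ‖B bᵢ‖²)^(1/2)` as an element of `[0, ∞]`; it is finite exactly
for Hilbert-Schmidt operators. The next lemmas show that any orthonormal basis may be used. -/
def hsNorm (B : H →L[ℝ] H) : ℝ≥0∞ :=
  (∑' i, ‖B (onb H i)‖ₑ ^ 2) ^ (1 / 2 : ℝ)

/-- Parseval's identity in `[0, ∞]`. -/
lemma tsum_enorm_inner_sq {ι : Type*} (b : HilbertBasis ι ℝ H) (v : H) :
    ∑' i, ‖⟪b i, v⟫‖ₑ ^ 2 = ‖v‖ₑ ^ 2 := by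
  have h := b.hasSum_inner_mul_inner v v
  have h2 : HasSum (fun i => ⟪b i, v⟫ ^ 2) (‖v‖ ^ 2) := by
    rw [← real_inner_self_eq_norm_sq]
    have hf : (fun i => ⟪b i, v⟫ ^ 2) = fun i => ⟪v, b i⟫ * ⟪b i, v⟫ := by
      funext i
      rw [real_inner_comm v (b i), sq]
    rw [hf]
    exact h
  have h3 := ENNReal.ofReal_tsum_of_nonneg (fun i => sq_nonneg ⟪b i, v⟫) h2.summable
  rw [h2.tsum_eq, ENNReal.ofReal_pow (norm_nonneg _), ofReal_norm] at h3
  rw [h3]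
  refine tsum_congr fun i => ?_
  rw [← sq_abs, ENNReal.ofReal_pow (abs_nonneg _), ← Real.norm_eq_abs, ofReal_norm]

lemma tsum_enorm_sq_adjoint {ι κ : Type*} (b : HilbertBasis ι ℝ H) (c : HilbertBasis κ ℝ H)
    (B : H →L[ℝ] H) :
    ∑' i, ‖B (b i)‖ₑ ^ 2 = ∑' j, ‖(ContinuousLinearMap.adjoint B) (c j)‖ₑ ^ 2 := by
  simp_rw [← tsum_enorm_inner_sq c (B _), ← tsum_enorm_inner_sq b (ContinuousLinearMap.adjoint B _)]
  rw [ENNReal.tsum_comm]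
  refine tsum_congr fun j => tsum_congr fun i => ?_
  rw [ContinuousLinearMap.adjoint_inner_right, real_inner_comm]

/-- The Hilbert-Schmidt norm can be computed in any orthonormal basis. -/
lemma hsNorm_eq {ι : Type*} (b : HilbertBasis ι ℝ H) (B : H →L[ℝ] H) :
    hsNorm B = (∑' i, ‖B (b i)‖ₑ ^ 2) ^ (1 / 2 : ℝ) := by
  rw [hsNorm, tsum_enorm_sq_adjoint (onb H) b B, ← tsum_enorm_sq_adjoint b b B]

/-- A covariance operator of trace class: symmetric, positive semidefinite, with finite trace. -/
structure IsTraceClassCovariance (Q : H →L[ℝ] H) : Prop where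
  isPositive : Q.IsPositive
  summable_trace : ∀ {s : Set H} (b : HilbertBasis s ℝ H), Summable fun i => ⟪Q (b i), b i⟫

/-! ### Diagonal operators and fractional powers -/

/-- The (possibly unbounded) diagonal operator `v ↦ ∑ cⱼ ⟪eⱼ, v⟫ eⱼ` on its natural domain
`{v | ∑ (cⱼ ⟪eⱼ, v⟫)² < ∞}`. -/
def diagOp (e : HilbertBasis ℕ ℝ H) (c : ℕ → ℝ) : H →ₗ.[ℝ] H where
  domain :=
    { carrier := {v | Memℓp (fun j => c j * ⟪e j, v⟫) 2}
      zero_mem' := by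
        have h : (fun j => c j * ⟪e j, (0 : H)⟫) = 0 := by ext j; simp
        change Memℓp _ 2
        rw [h]
        exact zero_memℓp
      add_mem' := by
        intro v w hv hw
        change Memℓp _ 2
        convert Memℓp.add hv hw using 1
        ext j
        simp [inner_add_right, mul_add]
      smul_mem' := by
        intro a v hv
        change Memℓp _ 2
        convert Memℓp.const_smul hv a using 1
        ext j
        simp [inner_smul_right, mul_left_comm] }
  toFun :=
    { toFun := fun v => e.repr.symm ⟨fun j => c j * ⟪e j, (v : H)⟫, v.2⟩
      map_add' := by
        intro v w
        rw [← map_add]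
        congr 1
        ext j
        change _ = c j * ⟪e j, (v : H)⟫ + c j * ⟪e j, (w : H)⟫
        simp [inner_add_right, mul_add]
      map_smul' := by
        intro a v
        rw [RingHom.id_apply, ← map_smul]
        congr 1
        ext j
        change _ = a * (c j * ⟪e j, (v : H)⟫)
        simp [inner_smul_right, mul_left_comm] }

lemma mem_graph_diagOp (e : HilbertBasis ℕ ℝ H) (c : ℕ → ℝ) (v w : H) :
    (v, w) ∈ (diagOp e c).graph ↔ ∀ j, ⟪e j, w⟫ = c j * ⟪e j, v⟫ := by
  rw [LinearPMap.mem_graph_iff]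
  constructor
  · rintro ⟨y, hy, hw⟩ j
    simp only at hy hw
    rw [← hw, ← e.repr_apply_apply, ← hy]
    change (e.repr (e.repr.symm _)) j = _
    rw [LinearIsometryEquiv.apply_symm_apply]
  · intro h
    have hfun : (fun j => c j * ⟪e j, v⟫) = (e.repr w : ℕ → ℝ) := by
      ext j
      rw [e.repr_apply_apply, h]
    have hmem : Memℓp (fun j => c j * ⟪e j, v⟫) 2 := by
      rw [hfun]
      exact lp.memℓp _
    refine ⟨⟨v, hmem⟩, rfl, ?_⟩
    change e.repr.symm _ = w
    rw [LinearIsometryEquiv.symm_apply_eq]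
    ext j
    exact congrFun hfun j

open Classical in
/-- The fractional power `A ^ r` of a positive definite self-adjoint operator `A` with compact
inverse: if `A = ∑ λⱼ ⟪eⱼ, ·⟫ eⱼ` with an orthonormal basis `(eⱼ)` and `λⱼ > 0`, then
`A ^ r = ∑ λⱼ ^ r ⟪eⱼ, ·⟫ eⱼ` on its natural domain. The next lemma shows that the result does not
depend on the choice of the eigenbasis. (If there is no such eigenbasis, the value is junk.) -/
def fracPow (A : H →ₗ.[ℝ] H) (r : ℝ) : H →ₗ.[ℝ] H :=
  if h : ∃ p : HilbertBasis ℕ ℝ H × (ℕ → ℝ), (∀ j, 0 < p.2 j) ∧ A = diagOp p.1 p.2 then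
    diagOp h.choose.1 (fun j => h.choose.2 j ^ r)
  else ⊥

lemma diagOp_rpow_le {e f : HilbertBasis ℕ ℝ H} {l m : ℕ → ℝ} (h : diagOp e l = diagOp f m)
    (r : ℝ) {v w : H} (hvw : (v, w) ∈ (diagOp e fun j => l j ^ r).graph) :
    (v, w) ∈ (diagOp f fun j => m j ^ r).graph := by
  rw [mem_graph_diagOp] at hvw ⊢
  have horth : ∀ i k, ⟪f k, e i⟫ * l i ^ r = ⟪f k, e i⟫ * m k ^ r := by
    intro i k
    have h1 : (e i, l i • e i) ∈ (diagOp e l).graph := by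
      rw [mem_graph_diagOp]
      intro j
      rw [inner_smul_right]
      by_cases hji : j = i
      · rw [hji]
      · simp [e.orthonormal.2 hji]
    rw [h, mem_graph_diagOp] at h1
    have h2 := h1 k
    rw [inner_smul_right] at h2
    by_cases h0 : ⟪f k, e i⟫ = 0
    · simp [h0]
    · rw [mul_right_cancel₀ h0 h2]
  intro k
  rw [← e.tsum_inner_mul_inner (f k) w, ← e.tsum_inner_mul_inner (f k) v, ← tsum_mul_left]
  refine tsum_congr fun i => ?_
  rw [hvw i, ← mul_assoc, horth i k]
  ring

lemma fracPow_diagOp (e : HilbertBasis ℕ ℝ H) (l : ℕ → ℝ) (hl : ∀ j, 0 < l j) (r : ℝ) :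
    fracPow (diagOp e l) r = diagOp e (fun j => l j ^ r) := by
  have h : ∃ p : HilbertBasis ℕ ℝ H × (ℕ → ℝ),
      (∀ j, 0 < p.2 j) ∧ diagOp e l = diagOp p.1 p.2 := ⟨(e, l), hl, rfl⟩
  rw [fracPow, dif_pos h]
  apply LinearPMap.eq_of_eq_graph
  ext ⟨v, w⟩
  exact ⟨diagOp_rpow_le h.choose_spec.2.symm r, diagOp_rpow_le h.choose_spec.2 r⟩

open Classical in
/-- `‖A ^ r v‖`, with the value `∞` if `v` is not in the domain of `A ^ r`. -/
def normPow (A : H →ₗ.[ℝ] H) (r : ℝ) (v : H) : ℝ≥0∞ :=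
  if h : v ∈ (fracPow A r).domain then ‖fracPow A r ⟨v, h⟩‖ₑ else ∞

/-! ### The assumptions on the operators -/

/-- `A` is closed, densely defined, self-adjoint, positive definite and has a compact inverse. -/
structure IsEllipticOperator (A : H →ₗ.[ℝ] H) : Prop where
  isClosed : A.IsClosed
  dense : Dense (A.domain : Set H)
  isSelfAdjoint : IsSelfAdjoint A
  posDef : ∀ v : A.domain, (v : H) ≠ 0 → 0 < ⟪A v, (v : H)⟫
  compact_inverse : ∃ K : H →L[ℝ] H, IsCompactOperator K ∧
    (∀ w : H, ∃ h : K w ∈ A.domain, A ⟨K w, h⟩ = w) ∧ ∀ v : A.domain, K (A v) = v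

/-- The assumptions on the pair `(A, Q)` with regularity index `γ`: `A` is as above, `Q` is a
trace class covariance, and `A ^ (γ / 2) Q` is an (everywhere defined) Hilbert-Schmidt operator. -/
structure OperatorAssumption (A : H →ₗ.[ℝ] H) (Q : H →L[ℝ] H) (γ : ℝ) : Prop where
  isEllipticOperator : IsEllipticOperator A
  isTraceClassCovariance : IsTraceClassCovariance Q
  hilbertSchmidt : ∃ B : H →L[ℝ] H,
    (∀ v, ∃ h : Q v ∈ (fracPow A (γ / 2)).domain, fracPow A (γ / 2) ⟨Q v, h⟩ = B v) ∧ hsNorm B < ∞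

/-- `S` is the strongly continuous semigroup with generator `-A`. -/
structure IsSemigroupGeneratedByNeg (S : ℝ → H →L[ℝ] H) (A : H →ₗ.[ℝ] H) : Prop where
  zero : S 0 = ContinuousLinearMap.id ℝ H
  add : ∀ s t : ℝ, 0 ≤ s → 0 ≤ t → S (s + t) = S s ∘L S t
  continuousOn : ∀ v, ContinuousOn (fun t => S t v) (Set.Ici 0)
  generator : ∀ v w : H, Tendsto (fun t : ℝ => t⁻¹ • (S t v - v)) (𝓝[>] 0) (𝓝 w) ↔
    ∃ h : v ∈ A.domain, -A ⟨v, h⟩ = w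

end Operators

section Processes

variable {H : Type*} [NormedAddCommGroup H] [InnerProductSpace ℝ H] [CompleteSpace H]
variable {Ω : Type*} {mΩ : MeasurableSpace Ω}

/-! ### Wiener processes, Wiener integrals and mild solutions -/

/-- `W` is a `Q`-Wiener process with respect to the filtration `ℱ`. -/
structure IsQWiener (W : ℝ≥0 → Ω → H) (Q : H →L[ℝ] H) (ℱ : Filtration ℝ≥0 mΩ)
    (P : Measure Ω) : Prop where
  zero : ∀ᵐ ω ∂P, W 0 ω = 0
  continuous : ∀ᵐ ω ∂P, Continuous fun t => W t ω
  adapted : StronglyAdapted ℱ W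
  indep : ∀ s t, s ≤ t →
    Indep (MeasurableSpace.comap (fun ω => W t ω - W s ω) (borel H)) (ℱ s) P
  gaussian : ∀ s t, s ≤ t → ∀ u : H,
    P.map (fun ω => ⟪W t ω - W s ω, u⟫) =
      gaussianReal 0 (Real.toNNReal (((t : ℝ) - s) * ⟪Q u, u⟫))

/-- An elementary deterministic integrand `∑ᵢ 1_{(aᵢ, bᵢ]} Bᵢ`. -/
structure ElementaryIntegrand (H : Type*) [NormedAddCommGroup H] [InnerProductSpace ℝ H] where
  n : ℕ
  left : Fin n → ℝ≥0
  right : Fin n → ℝ≥0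
  left_le_right : ∀ i, left i ≤ right i
  coeff : Fin n → H →L[ℝ] H

open Classical in
/-- The operator-valued step function of an elementary integrand. -/
def ElementaryIntegrand.eval (Φ : ElementaryIntegrand H) (s : ℝ) : H →L[ℝ] H :=
  ∑ i, if s ∈ Set.Ioc (Φ.left i : ℝ) (Φ.right i) then Φ.coeff i else 0

/-- The integral `∑ᵢ Bᵢ (W_{bᵢ} - W_{aᵢ})` of an elementary integrand. -/
def ElementaryIntegrand.integral (Φ : ElementaryIntegrand H) (W : ℝ≥0 → Ω → H) (ω : Ω) : H :=
  ∑ i, Φ.coeff i (W (Φ.right i) ω - W (Φ.left i) ω)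

/-- `Y` is the stochastic integral `∫₀ᵗ Ψ(s) dW_s` of the deterministic integrand `Ψ`: it is the
limit in `L²(Ω, H)` of integrals of elementary integrands `Φₙ` on `[0, t]` with
`∫₀ᵗ ‖(Φₙ(s) - Ψ(s)) Q^{1/2}‖² ds → 0` in Hilbert-Schmidt norm. By the Itô isometry, `Y` does not
depend on the sequence, up to null sets. -/
def IsWienerIntegral (W : ℝ≥0 → Ω → H) (Q : H →L[ℝ] H) (P : Measure Ω) (t : ℝ≥0)
    (Ψ : ℝ → H →L[ℝ] H) (Y : Ω → H) : Prop :=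
  MemLp Y 2 P ∧
  ∃ R : H →L[ℝ] H, R.IsPositive ∧ R ∘L R = Q ∧
  ∃ Φ : ℕ → ElementaryIntegrand H, (∀ n i, (Φ n).right i ≤ t) ∧
    Tendsto (fun n => ∫⁻ s in Set.Ioc (0 : ℝ) t, hsNorm (((Φ n).eval s - Ψ s) ∘L R) ^ 2)
      atTop (𝓝 0) ∧
    Tendsto (fun n => eLpNorm (fun ω => (Φ n).integral W ω - Y ω) 2 P) atTop (𝓝 0)

/-- `X` is the mild solution `X_t = S(t) X₀ + ∫₀ᵗ S(t - s) dW_s` of `dX + A X dt = dW`, where `S` is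
the semigroup generated by `-A`. -/
def IsMildSolution (A : H →ₗ.[ℝ] H) (Q : H →L[ℝ] H) (W : ℝ≥0 → Ω → H) (X₀ : Ω → H)
    (X : ℝ≥0 → Ω → H) (P : Measure Ω) : Prop :=
  ∃ S : ℝ → H →L[ℝ] H, IsSemigroupGeneratedByNeg S A ∧
    ∀ t : ℝ≥0, ∃ Y : Ω → H, IsWienerIntegral W Q P t (fun s => S (t - s)) Y ∧
      ∀ᵐ ω ∂P, X t ω = S t (X₀ ω) + Y ω

/-- The assumptions on the initial value with regularity index `ι`: it is `ℱ₀`-measurable, lies in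
`L⁴(Ω, H)`, and `‖A ^ (ι / 2) X₀‖_{L⁴(Ω, H)} < ∞`. -/
structure InitialAssumption (A : H →ₗ.[ℝ] H) (X₀ : Ω → H) (ι : ℝ) (ℱ : Filtration ℝ≥0 mΩ)
    (P : Measure Ω) : Prop where
  stronglyMeasurable : StronglyMeasurable[ℱ 0] X₀
  memLp : MemLp X₀ 4 P
  regularity : ∫⁻ ω, normPow A (ι / 2) (X₀ ω) ^ 4 ∂P < ∞

/-- The realized covariation `∑_{i=1}^{⌊T/Δ⌋} (X_{iΔ} - X_{(i-1)Δ})^{⊗2}` from perfect spatial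
observations. -/
def realizedCovariation (X : ℝ≥0 → Ω → H) (T Δ : ℝ≥0) (ω : Ω) : H →L[ℝ] H :=
  ∑ i ∈ Finset.range ⌊T / Δ⌋₊,
    InnerProductSpace.rankOne ℝ (X ((i + 1) * Δ) ω - X (i * Δ) ω) (X ((i + 1) * Δ) ω - X (i * Δ) ω)

/-- The norm of `L²(Ω, L₂(H))`. -/
def hsL2Norm (Z : Ω → H →L[ℝ] H) (P : Measure Ω) : ℝ≥0∞ :=
  (∫⁻ ω, hsNorm (Z ω) ^ 2 ∂P) ^ (1 / 2 : ℝ)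

end Processes

/-- The eigenvalues `μ_k = 1 / (k^{γ + 1/2} log k)`, `k ≥ 2`, and `μ₁ = 0`, indexed by
`k = j + 1`. -/
def noiseEigenvalue (γ : ℝ) (j : ℕ) : ℝ :=
  if j = 0 then 0 else 1 / ((j + 1 : ℝ) ^ (γ + 1 / 2) * Real.log (j + 1))

end

end RealizedCovariation

open RealizedCovariation

/-!
Over a time step `Δ` the `k`-th coordinate of the noise has variance `μ_k Δ`, but the
stochastic convolution in the direction `e_k` is pulled back at rate `λ_k`, so the variance of its
increment is at most `μ_k / λ_k`. Hence, as soon as `λ_k Δ ≥ 2`, the expected realized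
covariation falls short of `Q` by a fixed proportion of `μ_k` on the diagonal entry `(k, k)`, up to
a contribution of `X₀` that its spatial regularity controls. These missing variances are
summed over the window `K ≤ k < 2K` with `K ≍ Δ^(-1/2)`; by Cauchy-Schwarz the sum is at most `√K`
times the Hilbert-Schmidt norm of the bias, which is therefore of order at least
`√K μ_K ≍ Δ^(γ/2) / |log Δ|`.
-/

namespace RealizedCovariation

section Diagonal

variable {ι H : Type*} [NormedAddCommGroup H] [InnerProductSpace ℝ H]

lemma ext_inner_hilbertBasis (e : HilbertBasis ι ℝ H) {v w : H}
    (h : ∀ j, ⟪e j, v⟫ = ⟪e j, w⟫) : v = w := by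
  apply e.repr.injective
  ext j
  rw [e.repr_apply_apply, e.repr_apply_apply, h]

lemma inner_smul_basis_basis (e : HilbertBasis ι ℝ H) (c : ι → ℝ) (i j : ι) :
    ⟪e i, c j • e j⟫ = c i * ⟪e i, e j⟫ := by
  rw [inner_smul_right]
  obtain rfl | hij := eq_or_ne i j
  · rfl
  · rw [e.orthonormal.inner_eq_zero hij, mul_zero, mul_zero]

lemma hasSum_mul_inner_sq (e : HilbertBasis ι ℝ H) {c : ι → ℝ} {v w : H}
    (h : ∀ j, ⟪e j, w⟫ = c j * ⟪e j, v⟫) :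
    HasSum (fun j => c j * ⟪e j, v⟫ ^ 2) ⟪w, v⟫ := by
  refine (e.hasSum_inner_mul_inner w v).congr_fun fun j => ?_
  rw [real_inner_comm (e j), h]
  ring

lemma hasSum_inner_sq (e : HilbertBasis ι ℝ H) (v : H) :
    HasSum (fun j => ⟪e j, v⟫ ^ 2) (‖v‖ ^ 2) := by
  simpa only [Pi.one_apply, one_mul, real_inner_self_eq_norm_sq] using
    hasSum_mul_inner_sq e (c := 1) (v := v) (w := v) fun j => (one_mul _).symm

lemma norm_le_of_abs_inner_le (e : HilbertBasis ι ℝ H) {v w : H} {M : ℝ} (hM : 0 ≤ M)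
    (h : ∀ j, |⟪e j, w⟫| ≤ M * |⟪e j, v⟫|) : ‖w‖ ≤ M * ‖v‖ := by
  refine (sq_le_sq₀ (norm_nonneg _) (by positivity)).1 ?_
  rw [mul_pow]
  refine hasSum_le (fun j => ?_) (hasSum_inner_sq e w) ((hasSum_inner_sq e v).mul_left _)
  rw [← sq_abs, ← sq_abs ⟪e j, v⟫, ← mul_pow]
  exact pow_le_pow_left₀ (abs_nonneg _) (h j) 2

/-- The bounded operator `B` is diagonal in the orthonormal basis `e` with eigenvalues `c`, that is
`B = ∑ⱼ cⱼ ⟪eⱼ, ·⟫ eⱼ`, expressed coordinatewise to avoid convergence issues. -/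
def IsDiagonal (e : HilbertBasis ι ℝ H) (c : ι → ℝ) (B : H →L[ℝ] H) : Prop :=
  ∀ v j, ⟪e j, B v⟫ = c j * ⟪e j, v⟫

namespace IsDiagonal

variable {e : HilbertBasis ι ℝ H} {c : ι → ℝ} {B : H →L[ℝ] H}

lemma apply_basis (hB : IsDiagonal e c B) (j : ι) : B (e j) = c j • e j :=
  ext_inner_hilbertBasis e fun i => by rw [hB, inner_smul_basis_basis]

lemma norm_le (hB : IsDiagonal e c B) {M : ℝ} (hM : 0 ≤ M) (hc : ∀ j, |c j| ≤ M) : ‖B‖ ≤ M := by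
  refine B.opNorm_le_bound hM fun v => norm_le_of_abs_inner_le e hM fun j => ?_
  rw [hB, abs_mul]
  exact mul_le_mul_of_nonneg_right (hc j) (abs_nonneg _)

lemma isPositive (hB : IsDiagonal e c B) (hc : ∀ j, 0 ≤ c j) : B.IsPositive := by
  rw [ContinuousLinearMap.isPositive_def]
  refine ⟨fun v w => ?_, fun v => ?_⟩
  · refine (e.hasSum_inner_mul_inner (B v) w).unique ?_
    refine (e.hasSum_inner_mul_inner v (B w)).congr_fun fun j => ?_
    rw [hB, real_inner_comm, hB, real_inner_comm]
    ring
  · exact (hasSum_mul_inner_sq e (hB v)).nonneg fun j => mul_nonneg (hc j) (sq_nonneg _)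

variable [CompleteSpace H]

lemma isCompactOperator {e : HilbertBasis ℕ ℝ H} {c : ℕ → ℝ} (hB : IsDiagonal e c B)
    (hc : Tendsto c atTop (𝓝 0)) : IsCompactOperator B := by
  let F (n : ℕ) : H →L[ℝ] H :=
    ∑ i ∈ Finset.range n, c i • InnerProductSpace.rankOne ℝ (e i) (e i)
  have isCompactOperator_F (n : ℕ) : IsCompactOperator (F n) := by
    change F n ∈ compactOperator (RingHom.id ℝ) H H
    refine Submodule.sum_mem _ fun i _ => Submodule.smul_mem _ _ ?_
    rw [InnerProductSpace.rankOne_def']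
    exact (isCompactOperator_of_locallyCompactSpace_dom (innerSL ℝ (e i))).clm_comp
      (ContinuousLinearMap.toSpanSingleton ℝ (e i))
  have isDiagonal_F (n : ℕ) : IsDiagonal e (fun j => if j < n then c j else 0) (F n) := by
    intro v j
    simp only [F, _root_.sum_apply, inner_sum, _root_.smul_apply, InnerProductSpace.rankOne_apply,
      inner_smul_right, orthonormal_iff_ite.mp e.orthonormal]
    simp
  refine isCompactOperator_of_tendsto (F := F) (l := atTop) ?_ (.of_forall isCompactOperator_F)
  refine Metric.tendsto_atTop.2 fun ε hε => ?_
  obtain ⟨N, hN⟩ := Metric.tendsto_atTop.1 hc (ε / 2) (by positivity)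
  refine ⟨N, fun n hn => ?_⟩
  have isDiagonal_sub : IsDiagonal e (fun j => (if j < n then c j else 0) - c j) (F n - B) := by
    intro v j
    rw [_root_.sub_apply, inner_sub_right, isDiagonal_F, hB, sub_mul]
  refine (dist_eq_norm (F n) B).trans_lt (lt_of_le_of_lt ?_ (half_lt_self hε))
  refine isDiagonal_sub.norm_le (by positivity) fun j => ?_
  split_ifs with hj
  · simp only [sub_self, abs_zero]
    positivity
  · rw [zero_sub, abs_neg, ← sub_zero (c j)]
    exact (hN j (by omega)).le

lemma isTraceClassCovariance (hB : IsDiagonal e c B) (hc : ∀ j, 0 ≤ c j) (hs : Summable c) :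
    IsTraceClassCovariance B where
  isPositive := hB.isPositive hc
  summable_trace := by
    intro s b
    have trace_eq : ∑' i, ENNReal.ofReal ⟪B (b i), b i⟫ = ∑' j, ENNReal.ofReal (c j) :=
      calc ∑' i, ENNReal.ofReal ⟪B (b i), b i⟫
        _ = ∑' i, ∑' j, ENNReal.ofReal (c j) * ‖⟪b i, e j⟫‖ₑ ^ 2 := by
          refine tsum_congr fun i => ?_
          have h := hasSum_mul_inner_sq e (hB (b i))
          rw [← h.tsum_eq, ENNReal.ofReal_tsum_of_nonneg
            (fun j => mul_nonneg (hc j) (sq_nonneg _)) h.summable]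
          refine tsum_congr fun j => ?_
          rw [ENNReal.ofReal_mul (hc j), real_inner_comm, ← sq_abs,
            ENNReal.ofReal_pow (abs_nonneg _), Real.enorm_eq_ofReal_abs]
        _ = ∑' j, ENNReal.ofReal (c j) * ‖e j‖ₑ ^ 2 := by
          rw [ENNReal.tsum_comm]
          simp_rw [ENNReal.tsum_mul_left, tsum_enorm_inner_sq]
        _ = ∑' j, ENNReal.ofReal (c j) := by
          simp [← ofReal_norm (e _), e.orthonormal.1]
    have trace_ne_top : ∑' i, ENNReal.ofReal ⟪B (b i), b i⟫ ≠ ∞ := by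
      rw [trace_eq, ← ENNReal.ofReal_tsum_of_nonneg hc hs]
      exact ENNReal.ofReal_ne_top
    exact (ENNReal.summable_toReal trace_ne_top).congr fun i =>
      ENNReal.toReal_ofReal ((hB.isPositive hc).inner_nonneg_left _)

lemma hsNorm_lt_top (hB : IsDiagonal e c B) (hc : Summable fun j => c j ^ 2) : hsNorm B < ∞ := by
  rw [hsNorm_eq e]
  refine ENNReal.rpow_lt_top_of_nonneg (by norm_num) ?_
  have enorm_sq_eq (j : ι) : ‖B (e j)‖ₑ ^ 2 = ENNReal.ofReal (c j ^ 2) := by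
    rw [hB.apply_basis, ← ofReal_norm, norm_smul, e.orthonormal.1, mul_one, Real.norm_eq_abs,
      ← ENNReal.ofReal_pow (abs_nonneg _), sq_abs]
  simp_rw [enorm_sq_eq]
  rw [← ENNReal.ofReal_tsum_of_nonneg (fun j => sq_nonneg _) hc]
  exact ENNReal.ofReal_ne_top

end IsDiagonal

end Diagonal

section DiagOp

variable {H : Type*} [NormedAddCommGroup H] [InnerProductSpace ℝ H]

lemma exists_apply_eq_of_mem_graph {A : H →ₗ.[ℝ] H} {v w : H} (h : (v, w) ∈ A.graph) :
    ∃ hv : v ∈ A.domain, A ⟨v, hv⟩ = w := by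
  obtain ⟨y, rfl, hy⟩ := (LinearPMap.mem_graph_iff _).1 h
  exact ⟨y.2, hy⟩

variable [CompleteSpace H] (e : HilbertBasis ℕ ℝ H) (c : ℕ → ℝ)

lemma basis_mem_graph_diagOp (i : ℕ) : (e i, c i • e i) ∈ (diagOp e c).graph :=
  (mem_graph_diagOp e c _ _).2 fun j => inner_smul_basis_basis e c j i

lemma inner_diagOp (v : (diagOp e c).domain) (j : ℕ) :
    ⟪e j, diagOp e c v⟫ = c j * ⟪e j, (v : H)⟫ :=
  (mem_graph_diagOp e c v _).1 (LinearPMap.mem_graph _ v) j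

lemma dense_domain_diagOp : Dense ((diagOp e c).domain : Set H) := by
  have span_le : Submodule.span ℝ (Set.range e) ≤ (diagOp e c).domain := by
    rw [Submodule.span_le]
    rintro _ ⟨i, rfl⟩
    exact LinearPMap.mem_domain_of_mem_graph (basis_mem_graph_diagOp e c i)
  exact (Submodule.dense_iff_topologicalClosure_eq_top.2 e.dense_span).mono span_le

variable {e c}

lemma exists_isDiagonal (hc : BddAbove (Set.range fun j => |c j|)) :
    ∃ B : H →L[ℝ] H, IsDiagonal e c B := by
  obtain ⟨M, hM⟩ := hc
  replace hM (j : ℕ) : |c j| ≤ M := hM ⟨j, rfl⟩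
  have mem_domain (v : H) : v ∈ (diagOp e c).domain := by
    change Memℓp (fun j => c j * ⟪e j, v⟫) 2
    refine memℓp_gen (((hasSum_inner_sq e v).summable.mul_left (M ^ 2)).of_nonneg_of_le
      (fun j => by positivity) fun j => ?_)
    rw [ENNReal.toReal_ofNat, Real.rpow_ofNat, norm_mul, mul_pow, Real.norm_eq_abs,
      Real.norm_eq_abs, sq_abs ⟪e j, v⟫]
    gcongr
    exact hM j
  let L : H →ₗ[ℝ] H := (diagOp e c).toFun ∘ₗ LinearMap.id.codRestrict _ mem_domain
  have inner_L (v : H) (j : ℕ) : ⟪e j, L v⟫ = c j * ⟪e j, v⟫ := inner_diagOp e c ⟨v, _⟩ j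
  refine ⟨L.mkContinuous M fun v => ?_, inner_L⟩
  refine norm_le_of_abs_inner_le e ((abs_nonneg _).trans (hM 0)) fun j => ?_
  rw [inner_L, abs_mul]
  exact mul_le_mul_of_nonneg_right (hM j) (abs_nonneg _)

lemma exists_isCompactOperator_leftInverse_rightInverse_diagOp (hc : ∀ j, 0 < c j)
    (hlim : Tendsto c atTop atTop) :
    ∃ K : H →L[ℝ] H, IsCompactOperator K ∧
      (∀ w : H, ∃ h : K w ∈ (diagOp e c).domain, diagOp e c ⟨K w, h⟩ = w) ∧
      ∀ v : (diagOp e c).domain, K (diagOp e c v) = v := by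
  have tendsto_inv : Tendsto (fun j => (c j)⁻¹) atTop (𝓝 0) := tendsto_inv_atTop_zero.comp hlim
  obtain ⟨K, hK⟩ := exists_isDiagonal (e := e) tendsto_inv.abs.bddAbove_range
  refine ⟨K, hK.isCompactOperator tendsto_inv, fun w => exists_apply_eq_of_mem_graph ?_,
    fun v => ext_inner_hilbertBasis e fun j => ?_⟩
  · rw [mem_graph_diagOp]
    intro j
    rw [hK, mul_inv_cancel_left₀ (hc j).ne']
  · rw [hK, inner_diagOp, inv_mul_cancel_left₀ (hc j).ne']

lemma inner_diagOp_self_pos (hc : ∀ j, 0 < c j) (v : (diagOp e c).domain) (hv : (v : H) ≠ 0) :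
    0 < ⟪diagOp e c v, (v : H)⟫ := by
  obtain ⟨j, hj⟩ : ∃ j, ⟪e j, (v : H)⟫ ≠ 0 := by
    by_contra! h
    exact hv (ext_inner_hilbertBasis e fun j => by rw [h, inner_zero_right])
  have hsum := hasSum_mul_inner_sq e (inner_diagOp e c v)
  refine lt_of_lt_of_le (mul_pos (hc j) (by positivity : 0 < ⟪e j, (v : H)⟫ ^ 2)) ?_
  exact le_hasSum hsum j fun i _ => mul_nonneg (hc i).le (sq_nonneg _)

variable (e c) in
lemma isSelfAdjoint_diagOp : IsSelfAdjoint (diagOp e c) := by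
  rw [LinearPMap.isSelfAdjoint_def]
  apply LinearPMap.eq_of_eq_graph
  rw [LinearPMap.adjoint_graph_eq_graph_adjoint (dense_domain_diagOp e c)]
  ext ⟨v, w⟩
  rw [Submodule.mem_adjoint_iff, mem_graph_diagOp]
  constructor
  · intro h j
    have := h _ _ (basis_mem_graph_diagOp e c j)
    rw [real_inner_smul_left, sub_eq_zero] at this
    exact this.symm
  · intro h a b hab
    rw [mem_graph_diagOp] at hab
    simp only
    rw [sub_eq_zero, ← e.tsum_inner_mul_inner b v, ← e.tsum_inner_mul_inner a w]
    refine tsum_congr fun j => ?_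
    rw [real_inner_comm, hab, h, real_inner_comm a]
    ring

lemma isEllipticOperator_diagOp (hc : ∀ j, 0 < c j) (hlim : Tendsto c atTop atTop) :
    IsEllipticOperator (diagOp e c) where
  isClosed := (isSelfAdjoint_diagOp e c).isClosed
  dense := dense_domain_diagOp e c
  isSelfAdjoint := isSelfAdjoint_diagOp e c
  posDef := inner_diagOp_self_pos hc
  compact_inverse := exists_isCompactOperator_leftInverse_rightInverse_diagOp hc hlim

lemma IsDiagonal.operatorAssumption {l : ℕ → ℝ} {Q : H →L[ℝ] H} {γ : ℝ} (hQ : IsDiagonal e c Q)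
    (hl : ∀ j, 0 < l j) (hlim : Tendsto l atTop atTop) (hc : ∀ j, 0 ≤ c j) (hs : Summable c)
    (hs' : Summable fun j => (l j ^ (γ / 2) * c j) ^ 2) :
    OperatorAssumption (diagOp e l) Q γ where
  isEllipticOperator := isEllipticOperator_diagOp hl hlim
  isTraceClassCovariance := hQ.isTraceClassCovariance hc hs
  hilbertSchmidt := by
    have bddAbove_abs : BddAbove (Set.range fun j => |l j ^ (γ / 2) * c j|) := by
      simpa only [Real.sqrt_sq_eq_abs] using hs'.tendsto_atTop_zero.sqrt.bddAbove_range
    obtain ⟨B, hB⟩ := exists_isDiagonal (e := e) bddAbove_abs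
    rw [fracPow_diagOp e l hl]
    refine ⟨B, fun v => exists_apply_eq_of_mem_graph ?_, hB.hsNorm_lt_top hs'⟩
    rw [mem_graph_diagOp]
    intro j
    rw [hB, hQ, mul_assoc]

end DiagOp

section Eigenvalues

lemma noiseEigenvalue_nonneg (γ : ℝ) (j : ℕ) : 0 ≤ noiseEigenvalue γ j := by
  rw [noiseEigenvalue]
  split_ifs with h
  · rfl
  · have : 0 ≤ Real.log ((j : ℝ) + 1) := Real.log_nonneg (by simp)
    positivity

lemma summable_noiseEigenvalue {γ : ℝ} (hγ : 1 / 2 < γ) : Summable (noiseEigenvalue γ) := by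
  have summable_rpow : Summable fun n : ℕ => 1 / (n : ℝ) ^ (γ + 1 / 2) :=
    Real.summable_one_div_nat_rpow.2 (by linarith)
  refine (((summable_nat_add_iff 1).2 summable_rpow).mul_left (1 / Real.log 2)).of_nonneg_of_le
    (noiseEigenvalue_nonneg γ) fun j => ?_
  have : 0 < Real.log 2 := Real.log_pos one_lt_two
  rw [noiseEigenvalue]
  split_ifs with h
  · positivity
  · have hj : (1 : ℝ) ≤ j := by exact_mod_cast Nat.one_le_iff_ne_zero.2 h
    have : Real.log 2 ≤ Real.log ((j : ℝ) + 1) := Real.log_le_log (by norm_num) (by linarith)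
    push_cast
    rw [one_div_mul_one_div, mul_comm (Real.log 2)]
    gcongr

lemma summable_one_div_mul_log_sq : Summable fun n : ℕ => 1 / ((n : ℝ) * Real.log n ^ 2) := by
  rw [← summable_condensed_iff_of_eventually_nonneg]
  · refine ((Real.summable_one_div_nat_pow.2 one_lt_two).mul_left (1 / Real.log 2 ^ 2)).congr
      fun k => ?_
    push_cast
    rw [Real.log_pow, mul_pow]
    field_simp
  · exact Eventually.of_forall fun n => by positivity
  · filter_upwards [eventually_ge_atTop 2] with k hk
    have hk' : (2 : ℝ) ≤ k := by exact_mod_cast hk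
    have : 0 < Real.log k := Real.log_pos (by linarith)
    push_cast
    gcongr <;> linarith

lemma summable_weighted_noiseEigenvalue_sq (γ : ℝ) :
    Summable fun j : ℕ => ((((j : ℝ) + 1) ^ 2) ^ (γ / 2) * noiseEigenvalue γ j) ^ 2 := by
  refine ((summable_nat_add_iff 1).2 summable_one_div_mul_log_sq).of_nonneg_of_le
    (fun j => sq_nonneg _) fun j => ?_
  rw [noiseEigenvalue]
  split_ifs with h
  · rw [mul_zero, zero_pow two_ne_zero]
    positivity
  · have hj : (0 : ℝ) < (j : ℝ) + 1 := by positivity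
    apply le_of_eq
    push_cast
    rw [← Real.rpow_natCast ((j : ℝ) + 1) 2, ← Real.rpow_mul hj.le, Real.rpow_add hj]
    push_cast
    rw [mul_div_cancel₀ γ (by norm_num : (2 : ℝ) ≠ 0), ← Real.sqrt_eq_rpow, mul_one_div,
      mul_assoc, div_mul_cancel_left₀ (Real.rpow_pos_of_pos hj γ).ne', inv_pow, mul_pow,
      Real.sq_sqrt hj.le, one_div]

end Eigenvalues

section Semigroup

variable {H : Type*} [NormedAddCommGroup H] [InnerProductSpace ℝ H] {S : ℝ → H →L[ℝ] H}
  {A : H →ₗ.[ℝ] H}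

namespace IsSemigroupGeneratedByNeg

lemma hasDerivWithinAt (hS : IsSemigroupGeneratedByNeg S A) {v w : H} (hvw : (v, w) ∈ A.graph)
    {x : ℝ} (hx : 0 ≤ x) : HasDerivWithinAt (fun t => S t v) (S x (-w)) (Set.Ici x) x := by
  rw [← hasDerivWithinAt_Ioi_iff_Ici, hasDerivWithinAt_iff_tendsto_slope' Set.self_notMem_Ioi]
  obtain ⟨hv, hw⟩ := exists_apply_eq_of_mem_graph hvw
  have slope_zero := (hS.generator v (-w)).2 ⟨hv, by rw [hw]⟩
  have tendsto_sub : Tendsto (fun y : ℝ => y - x) (𝓝[>] x) (𝓝[>] 0) := by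
    refine tendsto_nhdsWithin_iff.2 ⟨?_, ?_⟩
    · rw [← sub_self x]
      exact ((continuous_sub_right x).tendsto x).mono_left nhdsWithin_le_nhds
    · filter_upwards [self_mem_nhdsWithin] with y hy using sub_pos.2 (Set.mem_Ioi.1 hy)
  refine (((S x).continuous.tendsto _).comp (slope_zero.comp tendsto_sub)).congr' ?_
  filter_upwards [self_mem_nhdsWithin] with y hy
  have hadd := hS.add x (y - x) hx (sub_pos.2 (Set.mem_Ioi.1 hy)).le
  rw [add_sub_cancel] at hadd
  simp only [Function.comp, slope, vsub_eq_sub, hadd, ContinuousLinearMap.comp_apply, map_smul,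
    map_sub]

lemma apply_eigenvector (hS : IsSemigroupGeneratedByNeg S A) {v : H} {l : ℝ}
    (hv : (v, l • v) ∈ A.graph) {t : ℝ} (ht : 0 ≤ t) : S t v = Real.exp (-(l * t)) • v := by
  have hasDerivAt_exp (x : ℝ) :
      HasDerivAt (fun x => Real.exp (l * x)) (Real.exp (l * x) * l) x := by
    simpa using ((hasDerivAt_id x).const_mul l).exp
  have eq_initial := constant_of_has_deriv_right_zero (a := 0) (b := t)
    (f := fun x => Real.exp (l * x) • S x v) ?_ ?_ t ⟨ht, le_rfl⟩
  · simp only [mul_zero, Real.exp_zero, hS.zero, ContinuousLinearMap.id_apply, one_smul]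
      at eq_initial
    rw [Real.exp_neg, eq_inv_smul_iff₀ (Real.exp_ne_zero _), eq_initial]
  · exact ContinuousOn.smul (by fun_prop) ((hS.continuousOn v).mono Set.Icc_subset_Ici_self)
  · intro x hx
    have h := (hasDerivAt_exp x).hasDerivWithinAt.smul (hS.hasDerivWithinAt hv hx.1)
    convert! h using 1
    rw [map_neg, map_smul, smul_neg, smul_smul, neg_add_cancel]

variable [CompleteSpace H] {e : HilbertBasis ℕ ℝ H} {l : ℕ → ℝ}

lemma adjoint_basis (hS : IsSemigroupGeneratedByNeg S (diagOp e l)) (k : ℕ) {t : ℝ} (ht : 0 ≤ t) :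
    ContinuousLinearMap.adjoint (S t) (e k) = Real.exp (-(l k * t)) • e k := by
  refine ext_inner_hilbertBasis e fun j => ?_
  rw [ContinuousLinearMap.adjoint_inner_right,
    hS.apply_eigenvector (basis_mem_graph_diagOp e l j) ht, real_inner_smul_left,
    inner_smul_basis_basis e (fun k => Real.exp (-(l k * t)))]

lemma inner_basis_apply (hS : IsSemigroupGeneratedByNeg S (diagOp e l)) (k : ℕ) {t : ℝ}
    (ht : 0 ≤ t) (v : H) : ⟪e k, S t v⟫ = Real.exp (-(l k * t)) * ⟪e k, v⟫ := by
  rw [← ContinuousLinearMap.adjoint_inner_left, hS.adjoint_basis k ht, real_inner_smul_left]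

end IsSemigroupGeneratedByNeg

end Semigroup

section WienerIncrements

variable {H : Type*} [NormedAddCommGroup H] [InnerProductSpace ℝ H]
variable {Ω : Type*} {mΩ : MeasurableSpace Ω} {P : Measure Ω}
variable {W : ℝ≥0 → Ω → H} {Q : H →L[ℝ] H} {ℱ : Filtration ℝ≥0 mΩ}

lemma volume_real_Ioc_inter_Ioc {a b c d : ℝ} (hab : a ≤ b) (hcd : c ≤ d) :
    volume.real (Set.Ioc a b ∩ Set.Ioc c d) = min b d - min a d - min b c + min a c := by
  rw [Set.Ioc_inter_Ioc, Real.volume_real_Ioc]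
  grind

namespace IsQWiener

lemma measurable_inner (hW : IsQWiener W Q ℱ P) (s t : ℝ≥0) (u : H) :
    Measurable fun ω => ⟪W t ω - W s ω, u⟫ :=
  ((((hW.adapted t).mono (ℱ.le t)).sub ((hW.adapted s).mono (ℱ.le s))).inner
    stronglyMeasurable_const).measurable

lemma memLp_inner (hW : IsQWiener W Q ℱ P) {s t : ℝ≥0} (hst : s ≤ t) (u : H) :
    MemLp (fun ω => ⟪W t ω - W s ω, u⟫) 2 P := by
  have h := memLp_id_gaussianReal' (μ := 0)
    (v := Real.toNNReal (((t : ℝ) - s) * ⟪Q u, u⟫)) 2 (by norm_num)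
  rw [← hW.gaussian s t hst u] at h
  exact (memLp_map_measure_iff h.1 (hW.measurable_inner s t u).aemeasurable).1 h

lemma integrable_inner_mul_inner (hW : IsQWiener W Q ℱ P) {a b c d : ℝ≥0} (hab : a ≤ b)
    (hcd : c ≤ d) (u v : H) :
    Integrable (fun ω => ⟪W b ω - W a ω, u⟫ * ⟪W d ω - W c ω, v⟫) P :=
  (hW.memLp_inner hab u).integrable_mul (hW.memLp_inner hcd v)

lemma integral_inner (hW : IsQWiener W Q ℱ P) {s t : ℝ≥0} (hst : s ≤ t) (u : H) :
    ∫ ω, ⟪W t ω - W s ω, u⟫ ∂P = 0 := by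
  have h := integral_id_gaussianReal (μ := 0) (v := Real.toNNReal (((t : ℝ) - s) * ⟪Q u, u⟫))
  rwa [← hW.gaussian s t hst u,
    integral_map (hW.measurable_inner s t u).aemeasurable (by fun_prop)] at h

lemma integral_inner_sq (hW : IsQWiener W Q ℱ P) (hQ : Q.IsPositive) {s t : ℝ≥0}
    (hst : s ≤ t) (u : H) :
    ∫ ω, ⟪W t ω - W s ω, u⟫ ^ 2 ∂P = ((t : ℝ) - s) * ⟪Q u, u⟫ := by
  have h := variance_id_gaussianReal (μ := 0) (v := Real.toNNReal (((t : ℝ) - s) * ⟪Q u, u⟫))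
  rw [variance_of_integral_eq_zero (by fun_prop) (by simp), ← hW.gaussian s t hst u,
    integral_map (hW.measurable_inner s t u).aemeasurable (by fun_prop)] at h
  simp only [id] at h
  rw [h, Real.coe_toNNReal]
  exact mul_nonneg (sub_nonneg.2 (NNReal.coe_le_coe.2 hst)) (hQ.inner_nonneg_left u)

lemma integral_inner_mul_inner (hW : IsQWiener W Q ℱ P) (hQ : Q.IsPositive) {s t : ℝ≥0}
    (hst : s ≤ t) (u v : H) :
    ∫ ω, ⟪W t ω - W s ω, u⟫ * ⟪W t ω - W s ω, v⟫ ∂P = ((t : ℝ) - s) * ⟪Q u, v⟫ := by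
  have polarization (ω : Ω) : ⟪W t ω - W s ω, u⟫ * ⟪W t ω - W s ω, v⟫ =
      (⟪W t ω - W s ω, u + v⟫ ^ 2 - ⟪W t ω - W s ω, u⟫ ^ 2 - ⟪W t ω - W s ω, v⟫ ^ 2) / 2 := by
    rw [inner_add_right]
    ring
  have integrable_sq (w : H) : Integrable (fun ω => ⟪W t ω - W s ω, w⟫ ^ 2) P :=
    (hW.memLp_inner hst w).integrable_sq
  have hsymm : ⟪Q v, u⟫ = ⟪Q u, v⟫ := (hQ.isSymmetric v u).trans (real_inner_comm _ _)
  simp_rw [polarization]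
  rw [integral_div,
    integral_sub (f := fun ω => ⟪W t ω - W s ω, u + v⟫ ^ 2 - ⟪W t ω - W s ω, u⟫ ^ 2)
      ((integrable_sq _).sub (integrable_sq _)) (integrable_sq _),
    integral_sub (integrable_sq _) (integrable_sq _), hW.integral_inner_sq hQ hst,
    hW.integral_inner_sq hQ hst, hW.integral_inner_sq hQ hst, map_add, inner_add_left,
    inner_add_right, inner_add_right, hsymm]
  ring

lemma integral_mul_inner (hW : IsQWiener W Q ℱ P) {s t : ℝ≥0} (hst : s ≤ t)
    {g : Ω → ℝ} (hg : StronglyMeasurable[ℱ s] g) (u : H) :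
    ∫ ω, g ω * ⟪W t ω - W s ω, u⟫ ∂P = 0 := by
  have comap_inner_le : MeasurableSpace.comap (fun ω => ⟪W t ω - W s ω, u⟫) inferInstance ≤
      MeasurableSpace.comap (fun ω => W t ω - W s ω) (borel H) := by
    let : MeasurableSpace H := borel H
    have : BorelSpace H := ⟨rfl⟩
    have measurable_inner_const : Measurable fun x : H => ⟪x, u⟫ :=
      (continuous_id.inner continuous_const).measurable
    change MeasurableSpace.comap ((fun x : H => ⟪x, u⟫) ∘ fun ω => W t ω - W s ω) _ ≤ _
    rw [← MeasurableSpace.comap_comp]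
    exact MeasurableSpace.comap_mono measurable_inner_const.comap_le
  have indepFun : IndepFun (fun ω => ⟪W t ω - W s ω, u⟫) g P :=
    indep_of_indep_of_le_left (indep_of_indep_of_le_right (hW.indep s t hst)
      hg.measurable.comap_le) comap_inner_le
  rw [indepFun.symm.integral_fun_mul_eq_mul_integral (hg.mono (ℱ.le s)).aestronglyMeasurable
    (hW.measurable_inner s t u).aestronglyMeasurable, hW.integral_inner hst, mul_zero]

lemma integral_inner_zero_mul_inner_zero (hW : IsQWiener W Q ℱ P) (hQ : Q.IsPositive)
    (s t : ℝ≥0) (u v : H) :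
    ∫ ω, ⟪W s ω - W 0 ω, u⟫ * ⟪W t ω - W 0 ω, v⟫ ∂P = min (s : ℝ) t * ⟪Q u, v⟫ := by
  wlog hst : s ≤ t generalizing s t u v
  · have hsymm : ⟪Q v, u⟫ = ⟪v, Q u⟫ := hQ.isSymmetric v u
    rw [min_comm, real_inner_comm, ← hsymm, ← this t s v u (le_of_not_ge hst)]
    exact integral_congr_ae (.of_forall fun ω => mul_comm _ _)
  have split_increment (ω : Ω) : ⟪W s ω - W 0 ω, u⟫ * ⟪W t ω - W 0 ω, v⟫ =
      ⟪W s ω - W 0 ω, u⟫ * ⟪W s ω - W 0 ω, v⟫ + ⟪W s ω - W 0 ω, u⟫ * ⟪W t ω - W s ω, v⟫ := by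
    rw [← mul_add, ← inner_add_left, sub_add_sub_cancel']
  have adapted_inner : StronglyMeasurable[ℱ s] fun ω => ⟪W s ω - W 0 ω, u⟫ :=
    ((hW.adapted s).sub ((hW.adapted 0).mono (ℱ.mono zero_le))).inner stronglyMeasurable_const
  simp_rw [split_increment]
  rw [integral_add (hW.integrable_inner_mul_inner zero_le zero_le u v)
    (hW.integrable_inner_mul_inner zero_le hst u v), hW.integral_inner_mul_inner hQ zero_le,
    hW.integral_mul_inner hst adapted_inner, min_eq_left (NNReal.coe_le_coe.2 hst)]
  simp

lemma integral_inner_increment_mul (hW : IsQWiener W Q ℱ P) (hQ : Q.IsPositive)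
    {a b c d : ℝ≥0} (hab : a ≤ b) (hcd : c ≤ d) (u v : H) :
    ∫ ω, ⟪W b ω - W a ω, u⟫ * ⟪W d ω - W c ω, v⟫ ∂P =
      volume.real (Set.Ioc (a : ℝ) b ∩ Set.Ioc (c : ℝ) d) * ⟪Q u, v⟫ := by
  let m (s t : ℝ≥0) (ω : Ω) : ℝ := ⟪W s ω - W 0 ω, u⟫ * ⟪W t ω - W 0 ω, v⟫
  have integrable_m (s t : ℝ≥0) : Integrable (m s t) P :=
    hW.integrable_inner_mul_inner zero_le zero_le u v
  have integral_m (s t : ℝ≥0) : ∫ ω, m s t ω ∂P = min (s : ℝ) t * ⟪Q u, v⟫ :=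
    hW.integral_inner_zero_mul_inner_zero hQ s t u v
  calc ∫ ω, ⟪W b ω - W a ω, u⟫ * ⟪W d ω - W c ω, v⟫ ∂P
    _ = ∫ ω, (m b d - m a d - m b c + m a c) ω ∂P := by
      refine integral_congr_ae (.of_forall fun ω => ?_)
      simp only [m, Pi.add_apply, Pi.sub_apply, inner_sub_left]
      ring
    _ = volume.real (Set.Ioc (a : ℝ) b ∩ Set.Ioc (c : ℝ) d) * ⟪Q u, v⟫ := by
      rw [integral_add' (((integrable_m b d).sub (integrable_m a d)).sub (integrable_m b c))
          (integrable_m a c),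
        integral_sub' ((integrable_m b d).sub (integrable_m a d)) (integrable_m b c),
        integral_sub' (integrable_m b d) (integrable_m a d),
        volume_real_Ioc_inter_Ioc (NNReal.coe_le_coe.2 hab) (NNReal.coe_le_coe.2 hcd)]
      simp only [integral_m]
      ring

end IsQWiener

end WienerIncrements

section WienerIntegral

variable {H : Type*} [NormedAddCommGroup H] [InnerProductSpace ℝ H]
variable {Ω : Type*} {mΩ : MeasurableSpace Ω} {P : Measure Ω}
variable {W : ℝ≥0 → Ω → H} {Q R : H →L[ℝ] H} {ℱ : Filtration ℝ≥0 mΩ}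

/-- The pairs `(1_{(a, b]} R v, ⟪W_b - W_a, v⟫)` of a deterministic step integrand and its
stochastic integral, where `R` is the square root of the covariance. -/
def wienerIncrementPairs (W : ℝ≥0 → Ω → H) (R : H →L[ℝ] H) (P : Measure Ω) :
    Set (Lp H 2 (volume : Measure ℝ) × Lp ℝ 2 P) :=
  {p | ∃ (a b : ℝ≥0) (v : H), a ≤ b ∧
    p.1 = indicatorConstLp 2 (measurableSet_Ioc (a := (a : ℝ)) (b := b))
      measure_Ioc_lt_top.ne (R v) ∧
    p.2 =ᵐ[P] fun ω => ⟪W b ω - W a ω, v⟫}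

/-- The graph of the isometric Wiener integral `L²(ℝ, H) ⊇ D → L²(P)`, encoded as a closed linear
relation so that its domain `D` need not be described. -/
noncomputable def wienerGraph (W : ℝ≥0 → Ω → H) (R : H →L[ℝ] H) (P : Measure Ω) :
    Submodule ℝ (Lp H 2 (volume : Measure ℝ) × Lp ℝ 2 P) :=
  (Submodule.span ℝ (wienerIncrementPairs W R P)).topologicalClosure

lemma indicatorConstLp_prod_inner_mem_wienerGraph (hW : IsQWiener W Q ℱ P) (R : H →L[ℝ] H)
    {a b : ℝ≥0} (hab : a ≤ b) (v : H) :
    (indicatorConstLp 2 (measurableSet_Ioc (a := (a : ℝ)) (b := b)) measure_Ioc_lt_top.ne (R v),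
      (hW.memLp_inner hab v).toLp fun ω => ⟪W b ω - W a ω, v⟫) ∈ wienerGraph W R P :=
  Submodule.le_topologicalClosure _ <| Submodule.subset_span
    ⟨a, b, v, hab, rfl, (hW.memLp_inner hab v).coeFn_toLp⟩

lemma inner_square_root_apply (hR : R.IsPositive) (hRQ : R ∘L R = Q) (u v : H) :
    ⟪R u, R v⟫ = ⟪Q u, v⟫ := by
  rw [← hRQ]
  exact (hR.isSymmetric (R u) v).symm

lemma norm_eq_of_comp_self_eq {R' : H →L[ℝ] H} (hR : R.IsPositive) (hR' : R'.IsPositive)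
    (h : R ∘L R = R' ∘L R') (v : H) : ‖R v‖ = ‖R' v‖ := by
  rw [norm_eq_sqrt_real_inner, norm_eq_sqrt_real_inner, inner_square_root_apply hR h,
    inner_square_root_apply hR' rfl]

lemma inner_fst_eq_inner_snd_of_mem_span [CompleteSpace H] (hW : IsQWiener W Q ℱ P)
    (hR : R.IsPositive) (hRQ : R ∘L R = Q) {p q : Lp H 2 (volume : Measure ℝ) × Lp ℝ 2 P}
    (hp : p ∈ Submodule.span ℝ (wienerIncrementPairs W R P))
    (hq : q ∈ Submodule.span ℝ (wienerIncrementPairs W R P)) : ⟪p.1, q.1⟫ = ⟪p.2, q.2⟫ := by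
  have hQ : Q.IsPositive := by
    simpa only [hR.isSelfAdjoint.adjoint_eq, hRQ] using
      ContinuousLinearMap.isPositive_adjoint_comp_self R
  induction hp, hq using Submodule.span_induction₂ with
  | mem_mem p q hp hq =>
    obtain ⟨a, b, u, hab, hp₁, hp₂⟩ := hp
    obtain ⟨c, d, v, hcd, hq₁, hq₂⟩ := hq
    rw [hp₁, hq₁, L2.inner_indicatorConstLp_indicatorConstLp _ _ measure_Ioc_lt_top.ne
      measure_Ioc_lt_top.ne, inner_square_root_apply hR hRQ, smul_eq_mul,
      ← hW.integral_inner_increment_mul hQ hab hcd, L2.inner_def]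
    refine integral_congr_ae ?_
    filter_upwards [hp₂, hq₂] with ω hpω hqω
    rw [hpω, hqω, Real.inner_apply]
  | zero_left q => simp
  | zero_right p => simp
  | add_left p p' q _ _ _ h h' => simp [inner_add_left, h, h']
  | add_right p q q' _ _ _ h h' => simp [inner_add_right, h, h']
  | smul_left r p q _ _ h => simp [real_inner_smul_left, h]
  | smul_right r p q _ _ h => simp [real_inner_smul_right, h]

theorem norm_fst_eq_norm_snd_of_mem_wienerGraph [CompleteSpace H] (hW : IsQWiener W Q ℱ P)
    (hR : R.IsPositive) (hRQ : R ∘L R = Q) {p : Lp H 2 (volume : Measure ℝ) × Lp ℝ 2 P}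
    (hp : p ∈ wienerGraph W R P) : ‖p.1‖ = ‖p.2‖ := by
  refine closure_minimal (fun q hq => ?_) (isClosed_eq continuous_fst.norm continuous_snd.norm) hp
  rw [Set.mem_ofPred_eq, norm_eq_sqrt_real_inner, norm_eq_sqrt_real_inner,
    inner_fst_eq_inner_snd_of_mem_span hW hR hRQ hq hq]

theorem inner_snd_eq_zero_of_mem_wienerGraph (hW : IsQWiener W Q ℱ P) {g : Ω → ℝ}
    (hg : StronglyMeasurable[ℱ 0] g) (hg₂ : MemLp g 2 P)
    {p : Lp H 2 (volume : Measure ℝ) × Lp ℝ 2 P} (hp : p ∈ wienerGraph W R P) :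
    ⟪hg₂.toLp g, p.2⟫ = 0 := by
  refine closure_minimal (fun q hq => ?_)
    (isClosed_eq (continuous_const.inner continuous_snd) continuous_const) hp
  rw [Set.mem_ofPred_eq]
  induction hq using Submodule.span_induction with
  | mem q hq =>
    obtain ⟨a, b, v, hab, -, hq₂⟩ := hq
    rw [← hW.integral_mul_inner hab (hg.mono (ℱ.mono zero_le)) v, L2.inner_def]
    refine integral_congr_ae ?_
    filter_upwards [hg₂.coeFn_toLp, hq₂] with ω hgω hqω
    rw [hgω, hqω, Real.inner_apply]
  | zero => exact inner_zero_right _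
  | add q q' _ _ h h' => rw [Prod.snd_add, inner_add_right, h, h', add_zero]
  | smul r q _ h => rw [Prod.smul_snd, real_inner_smul_right, h, mul_zero]

lemma eLpNorm_two_sq {α E : Type*} {m : MeasurableSpace α} {μ : Measure α}
    [NormedAddCommGroup E] (f : α → E) :
    eLpNorm f 2 μ ^ 2 = ∫⁻ x, ‖f x‖ₑ ^ 2 ∂μ := by
  have h := eLpNorm_nnreal_pow_eq_lintegral (f := f) (μ := μ) (p := 2) two_ne_zero
  simp only [ENNReal.coe_ofNat, NNReal.coe_ofNat] at h
  exact_mod_cast h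

lemma tendsto_zero_of_sq {α : Type*} {l : Filter α} {a : α → ℝ≥0∞}
    (h : Tendsto (fun n => a n ^ 2) l (𝓝 0)) : Tendsto a l (𝓝 0) := by
  have h := h.ennrpow_const (1 / 2)
  rw [ENNReal.zero_rpow_of_pos (by norm_num)] at h
  refine h.congr fun n => ?_
  rw [← ENNReal.rpow_natCast, ← ENNReal.rpow_mul]
  norm_num

lemma ElementaryIntegrand.eval_of_notMem_Ioc (Φ : ElementaryIntegrand H) {t : ℝ≥0}
    (hΦ : ∀ i, Φ.right i ≤ t) {s : ℝ} (hs : s ∉ Set.Ioc (0 : ℝ) t) : Φ.eval s = 0 :=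
  Finset.sum_eq_zero fun i _ => if_neg fun hi =>
    hs ⟨(Φ.left i).2.trans_lt hi.1, hi.2.trans (NNReal.coe_le_coe.2 (hΦ i))⟩

variable [CompleteSpace H]

lemma hsNorm_sq {ι : Type*} (b : HilbertBasis ι ℝ H) (B : H →L[ℝ] H) :
    hsNorm B ^ 2 = ∑' i, ‖B (b i)‖ₑ ^ 2 := by
  rw [hsNorm_eq b, ← ENNReal.rpow_natCast, ← ENNReal.rpow_mul]
  norm_num

lemma hsNorm_adjoint (B : H →L[ℝ] H) : hsNorm (ContinuousLinearMap.adjoint B) = hsNorm B := by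
  rw [hsNorm, hsNorm, tsum_enorm_sq_adjoint (onb H) (onb H) B]

lemma enorm_apply_le_hsNorm_mul_enorm (B : H →L[ℝ] H) (v : H) : ‖B v‖ₑ ≤ hsNorm B * ‖v‖ₑ := by
  refine (ENNReal.pow_le_pow_left_iff two_ne_zero).1 ?_
  rw [← hsNorm_adjoint, mul_pow, hsNorm_sq (onb H), ← tsum_enorm_inner_sq (onb H),
    ← ENNReal.tsum_mul_right]
  refine ENNReal.tsum_le_tsum fun i => ?_
  rw [← ContinuousLinearMap.adjoint_inner_left, ← mul_pow]
  gcongr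
  simpa only [enorm, ← ENNReal.coe_mul, ENNReal.coe_le_coe] using nnnorm_inner_le_nnnorm _ _

lemma enorm_apply_adjoint_le {R' : H →L[ℝ] H} (hR : R.IsPositive) (hR' : R'.IsPositive)
    (h : R ∘L R = R' ∘L R') (B : H →L[ℝ] H) (u : H) :
    ‖R (ContinuousLinearMap.adjoint B u)‖ₑ ≤ hsNorm (B ∘L R') * ‖u‖ₑ := by
  rw [← ofReal_norm, norm_eq_of_comp_self_eq hR hR' h, ofReal_norm, ← hsNorm_adjoint,
    ContinuousLinearMap.adjoint_comp, hR'.isSelfAdjoint.adjoint_eq]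
  exact enorm_apply_le_hsNorm_mul_enorm (R' ∘L ContinuousLinearMap.adjoint B) u

namespace ElementaryIntegrand

lemma inner_integral (Φ : ElementaryIntegrand H) (W : ℝ≥0 → Ω → H) (v : H) (ω : Ω) :
    ⟪v, Φ.integral W ω⟫ =
      ∑ i, ⟪W (Φ.right i) ω - W (Φ.left i) ω, ContinuousLinearMap.adjoint (Φ.coeff i) v⟫ := by
  rw [ElementaryIntegrand.integral, inner_sum]
  refine Finset.sum_congr rfl fun i _ => ?_
  rw [ContinuousLinearMap.adjoint_inner_right, real_inner_comm]

lemma apply_adjoint_eval (Φ : ElementaryIntegrand H) (R : H →L[ℝ] H) (v : H) (s : ℝ) :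
    R (ContinuousLinearMap.adjoint (Φ.eval s) v) =
      ∑ i, (Set.Ioc (Φ.left i : ℝ) (Φ.right i)).indicator
        (fun _ => R (ContinuousLinearMap.adjoint (Φ.coeff i) v)) s := by
  simp only [eval, map_sum, _root_.sum_apply]
  refine Finset.sum_congr rfl fun i _ => ?_
  by_cases h : s ∈ Set.Ioc (Φ.left i : ℝ) (Φ.right i) <;> simp [h]

lemma enorm_apply_adjoint_eval_sub_indicator_sq_le (Φ : ElementaryIntegrand H) {t : ℝ≥0}
    (hΦ : ∀ i, Φ.right i ≤ t) {R' : H →L[ℝ] H} (hR : R.IsPositive) (hR' : R'.IsPositive)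
    (h : R ∘L R = R' ∘L R') (Ψ : ℝ → H →L[ℝ] H) (u : H) (s : ℝ) :
    ‖R (ContinuousLinearMap.adjoint (Φ.eval s) u) - (Set.Ioc (0 : ℝ) t).indicator
        (fun s => R (ContinuousLinearMap.adjoint (Ψ s) u)) s‖ₑ ^ 2 ≤
      (Set.Ioc (0 : ℝ) t).indicator
        (fun s => hsNorm ((Φ.eval s - Ψ s) ∘L R') ^ 2 * ‖u‖ₑ ^ 2) s := by
  by_cases hs : s ∈ Set.Ioc (0 : ℝ) t
  · rw [Set.indicator_of_mem hs, Set.indicator_of_mem hs, ← mul_pow, ← map_sub,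
      ← _root_.sub_apply, ← map_sub]
    gcongr
    exact enorm_apply_adjoint_le hR hR' h _ u
  · simp [hs, Φ.eval_of_notMem_Ioc hΦ hs]

lemma exists_mem_wienerGraph (Φ : ElementaryIntegrand H) (hW : IsQWiener W Q ℱ P) (R : H →L[ℝ] H)
    (v : H) : ∃ p ∈ wienerGraph W R P,
      p.1 =ᵐ[volume] (fun s => R (ContinuousLinearMap.adjoint (Φ.eval s) v)) ∧
      p.2 =ᵐ[P] fun ω => ⟪v, Φ.integral W ω⟫ := by
  let f (i : Fin Φ.n) : Lp H 2 (volume : Measure ℝ) :=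
    indicatorConstLp 2 (measurableSet_Ioc (a := (Φ.left i : ℝ)) (b := Φ.right i))
      measure_Ioc_lt_top.ne (R (ContinuousLinearMap.adjoint (Φ.coeff i) v))
  let Z (i : Fin Φ.n) : Lp ℝ 2 P :=
    (hW.memLp_inner (Φ.left_le_right i) (ContinuousLinearMap.adjoint (Φ.coeff i) v)).toLp _
  refine ⟨∑ i, (f i, Z i), Submodule.sum_mem _ fun i _ =>
    indicatorConstLp_prod_inner_mem_wienerGraph hW R (Φ.left_le_right i) _, ?_, ?_⟩
  · rw [Prod.fst_sum]
    filter_upwards [Lp.coeFn_fun_finsetSum .univ f,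
      eventually_countable_forall.2 fun i => indicatorConstLp_coeFn (p := 2)
        (hs := measurableSet_Ioc (a := (Φ.left i : ℝ)) (b := Φ.right i))
        (hμs := measure_Ioc_lt_top.ne)
        (c := R (ContinuousLinearMap.adjoint (Φ.coeff i) v))] with s hsum hf
    simp only [hsum, f, hf, Φ.apply_adjoint_eval]
  · rw [Prod.snd_sum]
    filter_upwards [Lp.coeFn_fun_finsetSum .univ Z,
      eventually_countable_forall.2 fun i => (hW.memLp_inner (Φ.left_le_right i)
        (ContinuousLinearMap.adjoint (Φ.coeff i) v)).coeFn_toLp] with ω hsum hZ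
    simp only [hsum, Z, hZ, Φ.inner_integral]

end ElementaryIntegrand

theorem IsWienerIntegral.mem_wienerGraph (hW : IsQWiener W Q ℱ P) {t : ℝ≥0}
    {Ψ : ℝ → H →L[ℝ] H} {Y : Ω → H} (hY : IsWienerIntegral W Q P t Ψ Y) (hR : R.IsPositive)
    (hRQ : R ∘L R = Q) (u : H)
    (hf : MemLp ((Set.Ioc (0 : ℝ) t).indicator fun s => R (ContinuousLinearMap.adjoint (Ψ s) u))
      2 volume) :
    (hf.toLp _, (hY.1.const_inner u).toLp fun ω => ⟪u, Y ω⟫) ∈ wienerGraph W R P := by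
  obtain ⟨hY₂, R', hR', hRQ', Φ, hΦ, tendsto_eval, tendsto_integral⟩ := hY
  choose p hp hp₁ hp₂ using fun n => (Φ n).exists_mem_wienerGraph hW R u
  refine (Submodule.isClosed_topologicalClosure _).mem_of_tendsto (f := p) (b := atTop) ?_
    (.of_forall hp)
  refine Tendsto.prodMk_nhds
    ((Lp.tendsto_Lp_iff_tendsto_eLpNorm (fun n => (p n).1) _ hf).2 (tendsto_zero_of_sq ?_))
    ((Lp.tendsto_Lp_iff_tendsto_eLpNorm (fun n => (p n).2) _ (hY₂.const_inner u)).2 ?_)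
  · have tendsto_mul := ENNReal.Tendsto.mul_const tendsto_eval
      (Or.inr (ENNReal.pow_ne_top (n := 2) (enorm_ne_top (x := u))))
    rw [zero_mul] at tendsto_mul
    refine tendsto_of_tendsto_of_tendsto_of_le_of_le tendsto_const_nhds tendsto_mul
      (fun n => zero_le) fun n => ?_
    beta_reduce
    rw [eLpNorm_two_sq, ← lintegral_mul_const' _ _ (ENNReal.pow_ne_top enorm_ne_top),
      ← lintegral_indicator measurableSet_Ioc]
    refine lintegral_mono_ae ?_
    filter_upwards [hp₁ n] with s hs
    rw [Pi.sub_apply, hs]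
    exact (Φ n).enorm_apply_adjoint_eval_sub_indicator_sq_le (hΦ n) hR hR'
      (hRQ.trans hRQ'.symm) Ψ u s
  · have tendsto_mul := ENNReal.Tendsto.const_mul tendsto_integral
      (Or.inr (enorm_ne_top (x := u)))
    rw [mul_zero] at tendsto_mul
    refine tendsto_of_tendsto_of_tendsto_of_le_of_le tendsto_const_nhds tendsto_mul
      (fun n => zero_le) fun n => ?_
    beta_reduce
    rw [← ofReal_norm]
    refine eLpNorm_le_mul_eLpNorm_of_ae_le_mul ?_ 2
    filter_upwards [hp₂ n] with ω hω
    rw [Pi.sub_apply, hω, ← inner_sub_right]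
    exact norm_inner_le_norm _ _

end WienerIntegral

section Variance

lemma integral_sq_eq_norm_toLp_sq {α : Type*} {m : MeasurableSpace α} {μ : Measure α} {f : α → ℝ}
    (hf : MemLp f 2 μ) : ∫ x, f x ^ 2 ∂μ = ‖hf.toLp f‖ ^ 2 := by
  rw [← real_inner_self_eq_norm_sq, L2.inner_def]
  refine integral_congr_ae ?_
  filter_upwards [hf.coeFn_toLp] with x hx
  rw [hx, real_inner_self_eq_norm_sq, Real.norm_eq_abs, sq_abs]

lemma inner_toLp_smul_toLp_smul {α E : Type*} {m : MeasurableSpace α} {μ : Measure α}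
    [NormedAddCommGroup E] [InnerProductSpace ℝ E] {f g : α → ℝ} {w : E}
    (hf : MemLp (fun x => f x • w) 2 μ) (hg : MemLp (fun x => g x • w) 2 μ) :
    ⟪hf.toLp fun x => f x • w, hg.toLp fun x => g x • w⟫ = (∫ x, f x * g x ∂μ) * ‖w‖ ^ 2 := by
  rw [L2.inner_def, ← integral_mul_const]
  refine integral_congr_ae ?_
  filter_upwards [hf.coeFn_toLp, hg.coeFn_toLp] with x hfx hgx
  rw [hfx, hgx, real_inner_smul_left, real_inner_smul_right, real_inner_self_eq_norm_sq, mul_assoc]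

/-- The kernel `exp (-l (t - s))`, `0 < s ≤ t`, of the stochastic convolution, extended by zero. -/
noncomputable def expKernel (l t : ℝ) : ℝ → ℝ :=
  (Set.Ioc 0 t).indicator fun s => Real.exp (-(l * (t - s)))

lemma expKernel_nonneg (l t s : ℝ) : 0 ≤ expKernel l t s :=
  Set.indicator_nonneg (fun _ _ => (Real.exp_pos _).le) s

lemma memLp_expKernel (l t : ℝ) : MemLp (expKernel l t) 2 volume := by
  have hcont : Continuous fun s => Real.exp (-(l * (t - s))) := by fun_prop
  rw [expKernel, memLp_indicator_iff_restrict measurableSet_Ioc,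
    memLp_two_iff_integrable_sq hcont.aestronglyMeasurable]
  exact (hcont.pow 2).integrableOn_Icc.mono_set Set.Ioc_subset_Icc_self

lemma memLp_expKernel_smul {E : Type*} [NormedAddCommGroup E] [NormedSpace ℝ E] (l t : ℝ) (w : E) :
    MemLp (fun s => expKernel l t s • w) 2 volume :=
  (ContinuousLinearMap.toSpanSingleton ℝ w).comp_memLp' (memLp_expKernel l t)

lemma integral_expKernel_mul_self_le {l : ℝ} (hl : 0 < l) (t : ℝ) :
    ∫ s, expKernel l t s * expKernel l t s ≤ 1 / (2 * l) := by
  have hsq (s : ℝ) : expKernel l t s * expKernel l t s =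
      (Set.Ioc 0 t).indicator (fun s => Real.exp (-(2 * l * t)) * Real.exp (2 * l * s)) s := by
    by_cases hs : s ∈ Set.Ioc 0 t
    · simp only [expKernel, Set.indicator_of_mem hs, ← Real.exp_add]
      ring_nf
    · simp only [expKernel, Set.indicator_of_notMem hs, mul_zero]
  calc ∫ s, expKernel l t s * expKernel l t s
      = ∫ s in Set.Ioc 0 t, Real.exp (-(2 * l * t)) * Real.exp (2 * l * s) := by
        simp_rw [hsq]
        exact integral_indicator measurableSet_Ioc
    _ ≤ ∫ s in Set.Iic t, Real.exp (-(2 * l * t)) * Real.exp (2 * l * s) :=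
        setIntegral_mono_set ((integrableOn_exp_mul_Iic (by positivity) t).const_mul _)
          (.of_forall fun s => by positivity) Set.Ioc_subset_Iic_self.eventuallyLE
    _ = 1 / (2 * l) := by
        rw [integral_const_mul, integral_exp_mul_Iic (by positivity), mul_div_assoc',
          ← Real.exp_add, neg_add_cancel, Real.exp_zero]

lemma norm_toLp_expKernel_smul_sub_sq_le {E : Type*} [NormedAddCommGroup E] [InnerProductSpace ℝ E]
    {l : ℝ} (hl : 0 < l) (t t' : ℝ) (w : E) :
    ‖(memLp_expKernel_smul l t' w).toLp - (memLp_expKernel_smul l t w).toLp‖ ^ 2 ≤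
      ‖w‖ ^ 2 / l := by
  have norm_sq_le (r : ℝ) : ‖(memLp_expKernel_smul l r w).toLp‖ ^ 2 ≤ 1 / (2 * l) * ‖w‖ ^ 2 := by
    rw [← real_inner_self_eq_norm_sq, inner_toLp_smul_toLp_smul]
    gcongr
    exact integral_expKernel_mul_self_le hl r
  have inner_nonneg :
      0 ≤ ⟪(memLp_expKernel_smul l t' w).toLp, (memLp_expKernel_smul l t w).toLp⟫ := by
    rw [inner_toLp_smul_toLp_smul]
    exact mul_nonneg (integral_nonneg fun s =>
      mul_nonneg (expKernel_nonneg l t' s) (expKernel_nonneg l t s)) (sq_nonneg _)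
  calc _ ≤ 1 / (2 * l) * ‖w‖ ^ 2 + 1 / (2 * l) * ‖w‖ ^ 2 := by
        rw [norm_sub_sq_real]
        linarith [norm_sq_le t, norm_sq_le t']
    _ = ‖w‖ ^ 2 / l := by
        field_simp
        ring

variable {H : Type*} [NormedAddCommGroup H] [InnerProductSpace ℝ H] [CompleteSpace H]
variable {Ω : Type*} {mΩ : MeasurableSpace Ω} {P : Measure Ω}
variable {W : ℝ≥0 → Ω → H} {Q R : H →L[ℝ] H} {ℱ : Filtration ℝ≥0 mΩ}
variable {S : ℝ → H →L[ℝ] H} {e : HilbertBasis ℕ ℝ H} {l : ℕ → ℝ}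

namespace IsWienerIntegral

lemma toLp_expKernel_smul_mem_wienerGraph (hW : IsQWiener W Q ℱ P)
    (hS : IsSemigroupGeneratedByNeg S (diagOp e l)) {t : ℝ≥0} {Y : Ω → H}
    (hY : IsWienerIntegral W Q P t (fun s => S (t - s)) Y) (hR : R.IsPositive)
    (hRQ : R ∘L R = Q) (k : ℕ) :
    ((memLp_expKernel_smul (l k) t (R (e k))).toLp, (hY.1.const_inner (e k)).toLp) ∈
      wienerGraph W R P := by
  have adjoint_eq : ((Set.Ioc (0 : ℝ) t).indicator fun s =>
      R (ContinuousLinearMap.adjoint (S (t - s)) (e k))) =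
      fun s => expKernel (l k) t s • R (e k) := by
    funext s
    by_cases hs : s ∈ Set.Ioc (0 : ℝ) t
    · rw [expKernel, Set.indicator_of_mem hs, Set.indicator_of_mem hs,
        hS.adjoint_basis k (sub_nonneg.2 hs.2), map_smul]
    · rw [expKernel, Set.indicator_of_notMem hs, Set.indicator_of_notMem hs, zero_smul]
  have hmem := memLp_expKernel_smul (l k) t (R (e k))
  simp_rw [← adjoint_eq] at hmem ⊢
  exact hY.mem_wienerGraph hW hR hRQ (e k) hmem

theorem integral_add_inner_sub_sq_le (hW : IsQWiener W Q ℱ P)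
    (hS : IsSemigroupGeneratedByNeg S (diagOp e l)) {t t' : ℝ≥0} {Y Y' : Ω → H}
    (hY : IsWienerIntegral W Q P t (fun s => S (t - s)) Y)
    (hY' : IsWienerIntegral W Q P t' (fun s => S (t' - s)) Y') {k : ℕ} (hl : 0 < l k) {g : Ω → ℝ}
    (hg : StronglyMeasurable[ℱ 0] g) (hg₂ : MemLp g 2 P) :
    ∫ ω, (g ω + ⟪e k, Y' ω - Y ω⟫) ^ 2 ∂P ≤ ∫ ω, g ω ^ 2 ∂P + ⟪Q (e k), e k⟫ / l k := by
  obtain ⟨R, hR, hRQ, -⟩ := hY.2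
  have hZ : MemLp (fun ω => ⟪e k, Y' ω - Y ω⟫) 2 P := (hY'.1.sub hY.1).const_inner _
  have hmem := Submodule.sub_mem _ (hY'.toLp_expKernel_smul_mem_wienerGraph hW hS hR hRQ k)
    (hY.toLp_expKernel_smul_mem_wienerGraph hW hS hR hRQ k)
  have snd_eq : (hY'.1.const_inner (e k)).toLp - (hY.1.const_inner (e k)).toLp = hZ.toLp := by
    rw [← MemLp.toLp_sub]
    exact MemLp.toLp_congr _ _ (.of_forall fun ω => (inner_sub_right _ _ _).symm)
  rw [Prod.mk_sub_mk, snd_eq] at hmem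
  calc ∫ ω, (g ω + ⟪e k, Y' ω - Y ω⟫) ^ 2 ∂P
      = ‖hg₂.toLp g + hZ.toLp‖ ^ 2 := by
        rw [← MemLp.toLp_add, ← integral_sq_eq_norm_toLp_sq]
        rfl
    _ = ‖hg₂.toLp g‖ ^ 2 + ‖hZ.toLp‖ ^ 2 := by
        simpa only [← sq] using norm_add_sq_eq_norm_sq_add_norm_sq_real
          (inner_snd_eq_zero_of_mem_wienerGraph hW hg hg₂ hmem)
    _ ≤ ‖hg₂.toLp g‖ ^ 2 + ‖R (e k)‖ ^ 2 / l k := by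
        rw [← norm_fst_eq_norm_snd_of_mem_wienerGraph hW hR hRQ hmem]
        gcongr
        exact norm_toLp_expKernel_smul_sub_sq_le hl t t' (R (e k))
    _ = ∫ ω, g ω ^ 2 ∂P + ⟪Q (e k), e k⟫ / l k := by
        rw [integral_sq_eq_norm_toLp_sq hg₂, ← real_inner_self_eq_norm_sq (R (e k)),
          inner_square_root_apply hR hRQ]

end IsWienerIntegral

end Variance

section Bias

lemma sum_sub_sq_le_one_of_antitone {f : ℕ → ℝ} (hf : Antitone f) (hf₀ : ∀ i, 0 ≤ f i)
    (hf₁ : ∀ i, f i ≤ 1) (n : ℕ) : ∑ i ∈ Finset.range n, (f (i + 1) - f i) ^ 2 ≤ 1 :=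
  calc ∑ i ∈ Finset.range n, (f (i + 1) - f i) ^ 2
      ≤ ∑ i ∈ Finset.range n, (f i - f (i + 1)) := by
        refine Finset.sum_le_sum fun i _ => ?_
        rw [sub_sq_comm]
        exact pow_le_of_le_one (sub_nonneg.2 (hf i.le_succ))
          (by linarith [hf₀ (i + 1), hf₁ i]) two_ne_zero
    _ ≤ 1 := by
        rw [Finset.sum_range_sub']
        linarith [hf₀ n, hf₁ 0]

variable {H : Type*} [NormedAddCommGroup H] [InnerProductSpace ℝ H]
variable {Ω : Type*} {mΩ : MeasurableSpace Ω} {P : Measure Ω} {X : ℝ≥0 → Ω → H}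

lemma integrable_rankOne_self {x : Ω → H} (hx : MemLp x 2 P) :
    Integrable (fun ω => InnerProductSpace.rankOne ℝ (x ω) (x ω)) P := by
  have hcont : Continuous fun v : H => (InnerProductSpace.rankOne ℝ v v : H →L[ℝ] H) :=
    (InnerProductSpace.rankOne ℝ : H →L[ℝ] H →L⋆[ℝ] H →L[ℝ] H).continuous₂.comp
      (continuous_id.prodMk continuous_id)
  refine (integrable_norm_iff (hcont.comp_aestronglyMeasurable hx.1)).1 ?_
  simp only [InnerProductSpace.norm_rankOne, ← sq]
  exact hx.integrable_norm_pow two_ne_zero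

lemma integrable_realizedCovariation (hX : ∀ t, MemLp (X t) 2 P) (T Δ : ℝ≥0) :
    Integrable (realizedCovariation X T Δ) P := by
  have increment_memLp (i : ℕ) : MemLp (fun ω => X ((i + 1) * Δ) ω - X (i * Δ) ω) 2 P :=
    (hX _).sub (hX _)
  exact integrable_finsetSum (Finset.range ⌊T / Δ⌋₊)
    (f := fun (i : ℕ) ω => (InnerProductSpace.rankOne ℝ
      (X ((i + 1) * Δ) ω - X (i * Δ) ω) (X ((i + 1) * Δ) ω - X (i * Δ) ω) : H →L[ℝ] H))
    fun i _ => integrable_rankOne_self (increment_memLp i)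

variable [CompleteSpace H]

/-- The bias `E[RV_T^Δ / T] - Q` of the realized covariation as an estimator of `Q`. -/
noncomputable def bias (X : ℝ≥0 → Ω → H) (Q : H →L[ℝ] H) (T Δ : ℝ≥0) (P : Measure Ω) :
    H →L[ℝ] H :=
  (∫ ω, (T : ℝ)⁻¹ • realizedCovariation X T Δ ω ∂P) - Q

lemma inner_bias_apply (hX : ∀ t, MemLp (X t) 2 P) (Q : H →L[ℝ] H) (T Δ : ℝ≥0) (v : H) :
    ⟪v, bias X Q T Δ P v⟫ = (T : ℝ)⁻¹ * ∑ i ∈ Finset.range ⌊T / Δ⌋₊,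
      ∫ ω, ⟪v, X ((i + 1) * Δ) ω - X (i * Δ) ω⟫ ^ 2 ∂P - ⟪Q v, v⟫ := by
  have integrable := integrable_realizedCovariation hX T Δ
  have integrable_sq (i : ℕ) : Integrable (fun ω => ⟪v, X ((i + 1) * Δ) ω - X (i * Δ) ω⟫ ^ 2) P :=
    (((hX _).sub (hX _)).const_inner v).integrable_sq
  rw [bias, _root_.sub_apply, inner_sub_right, integral_smul, _root_.smul_apply, inner_smul_right,
    ContinuousLinearMap.integral_apply integrable,
    ← integral_inner (integrable.apply_continuousLinearMap v),
    ← integral_finsetSum _ fun i _ => integrable_sq i, real_inner_comm (Q v)]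
  congr 3
  funext ω
  simp only [realizedCovariation, _root_.sum_apply, inner_sum, InnerProductSpace.rankOne_apply,
    inner_smul_right]
  refine Finset.sum_congr rfl fun i _ => ?_
  rw [real_inner_comm, sq]

variable {W : ℝ≥0 → Ω → H} {X₀ : Ω → H} {A : H →ₗ.[ℝ] H} {Q : H →L[ℝ] H}
variable {ℱ : Filtration ℝ≥0 mΩ} {e : HilbertBasis ℕ ℝ H} {l : ℕ → ℝ}

namespace IsMildSolution

lemma memLp (hX : IsMildSolution A Q W X₀ X P) (hX₀ : MemLp X₀ 2 P) (t : ℝ≥0) :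
    MemLp (X t) 2 P := by
  obtain ⟨S, -, hS⟩ := hX
  obtain ⟨Y, hY, hXY⟩ := hS t
  exact (memLp_congr_ae hXY).2 (((S t).comp_memLp' hX₀).add hY.1)

lemma integral_inner_sub_sq_le (hX : IsMildSolution (diagOp e l) Q W X₀ X P)
    (hW : IsQWiener W Q ℱ P) (hX₀ : StronglyMeasurable[ℱ 0] X₀) (hX₀₂ : MemLp X₀ 2 P) {k : ℕ}
    (hl : 0 < l k) (t t' : ℝ≥0) :
    ∫ ω, ⟪e k, X t' ω - X t ω⟫ ^ 2 ∂P ≤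
      (Real.exp (-(l k * t')) - Real.exp (-(l k * t))) ^ 2 * ∫ ω, ⟪e k, X₀ ω⟫ ^ 2 ∂P +
        ⟪Q (e k), e k⟫ / l k := by
  obtain ⟨S, hS, hXS⟩ := hX
  obtain ⟨Y, hY, hXY⟩ := hXS t
  obtain ⟨Y', hY', hXY'⟩ := hXS t'
  set c := Real.exp (-(l k * t')) - Real.exp (-(l k * t)) with hc
  calc ∫ ω, ⟪e k, X t' ω - X t ω⟫ ^ 2 ∂P
      = ∫ ω, (c * ⟪e k, X₀ ω⟫ + ⟪e k, Y' ω - Y ω⟫) ^ 2 ∂P := by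
        refine integral_congr_ae ?_
        filter_upwards [hXY, hXY'] with ω hω hω'
        rw [hω, hω', add_sub_add_comm, inner_add_right, inner_sub_right,
          hS.inner_basis_apply k (NNReal.coe_nonneg t),
          hS.inner_basis_apply k (NNReal.coe_nonneg t'), ← sub_mul, hc]
    _ ≤ ∫ ω, (c * ⟪e k, X₀ ω⟫) ^ 2 ∂P + ⟪Q (e k), e k⟫ / l k :=
        hY.integral_add_inner_sub_sq_le hW hS hY' hl
          ((stronglyMeasurable_const.inner hX₀).const_mul c) ((hX₀₂.const_inner _).const_mul c)
    _ = c ^ 2 * ∫ ω, ⟪e k, X₀ ω⟫ ^ 2 ∂P + ⟪Q (e k), e k⟫ / l k := by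
        simp only [mul_pow, integral_const_mul]

lemma sum_integral_inner_sub_sq_le (hX : IsMildSolution (diagOp e l) Q W X₀ X P)
    (hW : IsQWiener W Q ℱ P) (hX₀ : StronglyMeasurable[ℱ 0] X₀) (hX₀₂ : MemLp X₀ 2 P) {k : ℕ}
    (hl : 0 < l k) (Δ : ℝ≥0) (n : ℕ) :
    ∑ i ∈ Finset.range n, ∫ ω, ⟪e k, X ((i + 1) * Δ) ω - X (i * Δ) ω⟫ ^ 2 ∂P ≤
      ∫ ω, ⟪e k, X₀ ω⟫ ^ 2 ∂P + n * (⟪Q (e k), e k⟫ / l k) := by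
  let f (i : ℕ) : ℝ := Real.exp (-(l k * (i * Δ)))
  have sum_le_one : ∑ i ∈ Finset.range n, (f (i + 1) - f i) ^ 2 ≤ 1 := by
    have antitone_f : Antitone f := fun i j hij => by
      dsimp only [f]
      gcongr
    exact sum_sub_sq_le_one_of_antitone antitone_f (fun i => (Real.exp_pos _).le)
      (fun i => Real.exp_le_one_iff.2 (neg_nonpos.2 (by positivity : 0 ≤ l k * (i * Δ)))) n
  calc ∑ i ∈ Finset.range n, ∫ ω, ⟪e k, X ((i + 1) * Δ) ω - X (i * Δ) ω⟫ ^ 2 ∂P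
      ≤ ∑ i ∈ Finset.range n, ((f (i + 1) - f i) ^ 2 * ∫ ω, ⟪e k, X₀ ω⟫ ^ 2 ∂P +
          ⟪Q (e k), e k⟫ / l k) := by
        refine Finset.sum_le_sum fun i _ => ?_
        exact_mod_cast hX.integral_inner_sub_sq_le hW hX₀ hX₀₂ hl (i * Δ) ((i + 1) * Δ)
    _ = (∑ i ∈ Finset.range n, (f (i + 1) - f i) ^ 2) * ∫ ω, ⟪e k, X₀ ω⟫ ^ 2 ∂P +
          n * (⟪Q (e k), e k⟫ / l k) := by
        rw [Finset.sum_add_distrib, Finset.sum_mul, Finset.sum_const, Finset.card_range,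
          nsmul_eq_mul]
    _ ≤ _ := by
        gcongr
        exact mul_le_of_le_one_left (integral_nonneg fun _ => sq_nonneg _) sum_le_one

theorem inner_bias_apply_le (hX : IsMildSolution (diagOp e l) Q W X₀ X P)
    (hW : IsQWiener W Q ℱ P) (hX₀ : StronglyMeasurable[ℱ 0] X₀) (hX₀₂ : MemLp X₀ 2 P) {T Δ : ℝ≥0}
    (hT : 0 < T) {k : ℕ} (hl : 0 < l k) (hlΔ : 2 ≤ l k * Δ) (hQ : 0 ≤ ⟪Q (e k), e k⟫) :
    ⟪e k, bias X Q T Δ P (e k)⟫ ≤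
      (T : ℝ)⁻¹ * ∫ ω, ⟪e k, X₀ ω⟫ ^ 2 ∂P - ⟪Q (e k), e k⟫ / 2 := by
  have hT : (0 : ℝ) < T := hT
  have hΔ : (0 : ℝ) < Δ := pos_of_mul_pos_right (two_pos.trans_le hlΔ) hl.le
  set q := ⟪Q (e k), e k⟫
  have floor_le : (⌊T / Δ⌋₊ : ℝ) ≤ T / Δ := by exact_mod_cast Nat.floor_le (zero_le (a := T / Δ))
  have noise_le : (T : ℝ)⁻¹ * (⌊T / Δ⌋₊ * (q / l k)) ≤ q / 2 :=
    calc (T : ℝ)⁻¹ * (⌊T / Δ⌋₊ * (q / l k)) ≤ (T : ℝ)⁻¹ * (T / Δ * (q / l k)) := by gcongr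
      _ = q / (l k * Δ) := by field_simp
      _ ≤ q / 2 := by gcongr
  have sum_le := mul_le_mul_of_nonneg_left
    (hX.sum_integral_inner_sub_sq_le hW hX₀ hX₀₂ hl Δ ⌊T / Δ⌋₊) (inv_nonneg.2 hT.le)
  rw [inner_bias_apply (hX.memLp hX₀₂)]
  linarith

end IsMildSolution

end Bias

section HilbertSchmidtBounds

variable {ι H : Type*} [NormedAddCommGroup H] [InnerProductSpace ℝ H] [CompleteSpace H]

lemma ofReal_abs_sum_inner_div_sqrt_card_le_hsNorm (e : HilbertBasis ι ℝ H) (B : H →L[ℝ] H)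
    (s : Finset ι) : ENNReal.ofReal (|∑ k ∈ s, ⟪e k, B (e k)⟫| / √(s.card)) ≤ hsNorm B := by
  rcases s.eq_empty_or_nonempty with rfl | hs
  · simp
  have hcard : (0 : ℝ) < s.card := by exact_mod_cast hs.card_pos
  have inner_le (k : ι) : |⟪e k, B (e k)⟫| ≤ ‖B (e k)‖ := by
    simpa only [e.orthonormal.1 k, one_mul] using abs_real_inner_le_norm (e k) (B (e k))
  have sq_sum_le : (∑ k ∈ s, ⟪e k, B (e k)⟫) ^ 2 ≤ (∑ k ∈ s, ‖B (e k)‖ ^ 2) * s.card := by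
    rw [mul_comm]
    refine sq_sum_le_card_mul_sum_sq.trans ?_
    exact mul_le_mul_of_nonneg_left (Finset.sum_le_sum fun k _ =>
      sq_le_sq.2 ((inner_le k).trans_eq (abs_norm _).symm)) hcard.le
  rw [← ENNReal.pow_le_pow_left_iff two_ne_zero]
  calc ENNReal.ofReal (|∑ k ∈ s, ⟪e k, B (e k)⟫| / √(s.card)) ^ 2
      = ENNReal.ofReal ((∑ k ∈ s, ⟪e k, B (e k)⟫) ^ 2 / s.card) := by
        rw [← ENNReal.ofReal_pow (by positivity), div_pow, sq_abs, Real.sq_sqrt hcard.le]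
    _ ≤ ENNReal.ofReal (∑ k ∈ s, ‖B (e k)‖ ^ 2) :=
        ENNReal.ofReal_le_ofReal ((div_le_iff₀ hcard).2 sq_sum_le)
    _ = ∑ k ∈ s, ‖B (e k)‖ₑ ^ 2 := by
        rw [ENNReal.ofReal_sum_of_nonneg fun _ _ => sq_nonneg _]
        simp only [ENNReal.ofReal_pow (norm_nonneg _), ofReal_norm]
    _ ≤ hsNorm B ^ 2 := by
        rw [hsNorm_sq e]
        exact ENNReal.sum_le_tsum s

variable {Ω : Type*} {mΩ : MeasurableSpace Ω} {P : Measure Ω} [IsProbabilityMeasure P]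

lemma hsNorm_integral_le_hsL2Norm [Countable ι] (e : HilbertBasis ι ℝ H) {Z : Ω → H →L[ℝ] H}
    (hZ : Integrable Z P) : hsNorm (∫ ω, Z ω ∂P) ≤ hsL2Norm Z P := by
  have measurable_apply (j : ι) : AEStronglyMeasurable (fun ω => Z ω (e j)) P :=
    (hZ.apply_continuousLinearMap (e j)).1
  rw [hsL2Norm, one_div, ENNReal.le_rpow_inv_iff two_pos, ENNReal.rpow_two, hsNorm_sq e]
  simp_rw [hsNorm_sq e]
  rw [lintegral_tsum fun j => (measurable_apply j).enorm.pow_const 2]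
  refine ENNReal.tsum_le_tsum fun j => ?_
  rw [ContinuousLinearMap.integral_apply hZ, ← eLpNorm_two_sq]
  gcongr
  calc ‖∫ ω, Z ω (e j) ∂P‖ₑ ≤ eLpNorm (fun ω => Z ω (e j)) 1 P := by
        rw [eLpNorm_one_eq_lintegral_enorm]
        exact enorm_integral_le_lintegral_enorm _
    _ ≤ eLpNorm (fun ω => Z ω (e j)) 2 P :=
        eLpNorm_le_eLpNorm_of_exponent_le one_le_two (measurable_apply j)

lemma hsNorm_bias_le_hsL2Norm [Countable ι] (e : HilbertBasis ι ℝ H) {X : ℝ≥0 → Ω → H}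
    (hX : ∀ t, MemLp (X t) 2 P) (Q : H →L[ℝ] H) (T Δ : ℝ≥0) :
    hsNorm (bias X Q T Δ P) ≤
      hsL2Norm (fun ω => (T : ℝ)⁻¹ • realizedCovariation X T Δ ω - Q) P := by
  have integrable : Integrable (fun ω => (T : ℝ)⁻¹ • realizedCovariation X T Δ ω) P :=
    (integrable_realizedCovariation hX T Δ).fun_smul _
  have bias_eq : bias X Q T Δ P =
      ∫ ω, ((T : ℝ)⁻¹ • realizedCovariation X T Δ ω - Q) ∂P := by
    rw [integral_sub integrable (integrable_const Q), integral_const, probReal_univ, one_smul, bias]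
  rw [bias_eq]
  exact hsNorm_integral_le_hsL2Norm e (integrable.sub (integrable_const Q))

end HilbertSchmidtBounds

section InitialValue

variable {H : Type*} [NormedAddCommGroup H] [InnerProductSpace ℝ H]
variable {Ω : Type*} {mΩ : MeasurableSpace Ω} {P : Measure Ω} [IsProbabilityMeasure P]
variable {X₀ : Ω → H} {ι : ℝ} {ℱ : Filtration ℝ≥0 mΩ}

lemma InitialAssumption.memLp_two {A : H →ₗ.[ℝ] H} (h : InitialAssumption A X₀ ι ℱ P) :
    MemLp X₀ 2 P :=
  h.memLp.mono_exponent (by norm_num)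

variable [CompleteSpace H] {e : HilbertBasis ℕ ℝ H} {l : ℕ → ℝ}

lemma ofReal_sum_rpow_mul_inner_sq_le_normPow_sq (hl : ∀ j, 0 < l j) (r : ℝ) (v : H)
    (s : Finset ℕ) :
    ENNReal.ofReal (∑ j ∈ s, l j ^ (2 * r) * ⟪e j, v⟫ ^ 2) ≤ normPow (diagOp e l) r v ^ 2 := by
  rw [normPow]
  split_ifs with hv
  · have hgraph := LinearPMap.mem_graph (fracPow (diagOp e l) r) ⟨v, hv⟩
    generalize fracPow (diagOp e l) r ⟨v, hv⟩ = w at hgraph ⊢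
    simp only [fracPow_diagOp e l hl, mem_graph_diagOp] at hgraph
    calc ENNReal.ofReal (∑ j ∈ s, l j ^ (2 * r) * ⟪e j, v⟫ ^ 2)
        = ENNReal.ofReal (∑ j ∈ s, ‖⟪e j, w⟫‖ ^ 2) := by
          congr 1
          refine Finset.sum_congr rfl fun j _ => ?_
          rw [hgraph j, Real.norm_eq_abs, sq_abs, mul_pow, mul_comm 2 r, Real.rpow_mul (hl j).le,
            Real.rpow_two]
      _ = ∑ j ∈ s, ‖⟪e j, w⟫‖ₑ ^ 2 := by
          rw [ENNReal.ofReal_sum_of_nonneg fun _ _ => sq_nonneg _]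
          simp only [ENNReal.ofReal_pow (norm_nonneg _), ofReal_norm]
      _ ≤ ‖w‖ₑ ^ 2 := by
          rw [← tsum_enorm_inner_sq e]
          exact ENNReal.sum_le_tsum s
  · simp

lemma InitialAssumption.exists_sum_rpow_mul_integral_inner_sq_le
    (h : InitialAssumption (diagOp e l) X₀ ι ℱ P) (hl : ∀ j, 0 < l j) :
    ∃ M : ℝ, ∀ s : Finset ℕ, ∑ j ∈ s, l j ^ ι * ∫ ω, ⟪e j, X₀ ω⟫ ^ 2 ∂P ≤ M := by
  have integrable (j : ℕ) : Integrable (fun ω => l j ^ ι * ⟪e j, X₀ ω⟫ ^ 2) P :=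
    (h.memLp_two.const_inner (e j)).integrable_sq.const_mul _
  have sq_le_one_add_pow_four (x : ℝ≥0∞) : x ^ 2 ≤ 1 + x ^ 4 := by
    rcases le_total x 1 with hx | hx
    · exact le_add_right (pow_le_one₀ zero_le hx)
    · exact le_add_left (pow_le_pow_right₀ hx (by norm_num))
  have hfin : 1 + ∫⁻ ω, normPow (diagOp e l) (ι / 2) (X₀ ω) ^ 4 ∂P ≠ ∞ :=
    ENNReal.add_ne_top.2 ⟨ENNReal.one_ne_top, h.regularity.ne⟩
  refine ⟨_, fun s => (ENNReal.ofReal_le_iff_le_toReal hfin).1 ?_⟩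
  simp_rw [← integral_const_mul]
  rw [← integral_finsetSum _ fun j _ => integrable j, ofReal_integral_eq_lintegral_ofReal
    (integrable_finsetSum _ fun j _ => integrable j)
    (.of_forall fun ω => Finset.sum_nonneg fun j _ =>
      mul_nonneg (Real.rpow_nonneg (hl j).le _) (sq_nonneg _))]
  calc ∫⁻ ω, ENNReal.ofReal (∑ j ∈ s, l j ^ ι * ⟪e j, X₀ ω⟫ ^ 2) ∂P
      ≤ ∫⁻ ω, (1 + normPow (diagOp e l) (ι / 2) (X₀ ω) ^ 4) ∂P := by
        refine lintegral_mono fun ω => le_trans ?_ (sq_le_one_add_pow_four _)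
        simpa only [mul_div_cancel₀ ι two_ne_zero] using
          ofReal_sum_rpow_mul_inner_sq_le_normPow_sq hl (ι / 2) (X₀ ω) s
    _ = 1 + ∫⁻ ω, normPow (diagOp e l) (ι / 2) (X₀ ω) ^ 4 ∂P := by
        rw [lintegral_add_left measurable_const, lintegral_one, measure_univ]

end InitialValue

section Window

lemma noiseEigenvalue_ge {γ : ℝ} (hγ : 0 ≤ γ) {K j : ℕ} (hj : j ∈ Finset.Ico K (2 * K)) :
    1 / ((2 * K : ℝ) ^ (γ + 1 / 2) * Real.log (2 * K)) ≤ noiseEigenvalue γ j := by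
  obtain ⟨hKj, hjK⟩ := Finset.mem_Ico.1 hj
  have hj₁ : (1 : ℝ) ≤ j := by exact_mod_cast (by omega : 1 ≤ j)
  have hjK : (j : ℝ) + 1 ≤ 2 * K := by exact_mod_cast hjK
  have log_pos : 0 < Real.log ((j : ℝ) + 1) := Real.log_pos (by linarith)
  rw [noiseEigenvalue, if_neg (by omega)]
  gcongr

/-- A scale `K ≍ Δ^(-1/2)` such that the eigenvalues `k² ≥ K²` satisfy `k² Δ ≥ 4`: over one time
step `Δ`, the modes `k ≥ K` lose most of their memory. -/
noncomputable def window (Δ : ℝ) : ℕ :=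
  ⌈2 / √Δ⌉₊

lemma window_pos {Δ : ℝ} (hΔ : 0 < Δ) : 0 < window Δ :=
  Nat.ceil_pos.2 (by positivity)

lemma tendsto_window : Tendsto window (𝓝[>] 0) atTop := by
  have tendsto_sqrt : Tendsto Real.sqrt (𝓝[>] 0) (𝓝[>] 0) := by
    refine tendsto_nhdsWithin_iff.2 ⟨?_, ?_⟩
    · simpa only [Real.sqrt_zero] using
        (Real.continuous_sqrt.tendsto 0).mono_left nhdsWithin_le_nhds
    · filter_upwards [self_mem_nhdsWithin] with Δ hΔ using Real.sqrt_pos.2 hΔ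
  exact tendsto_nat_ceil_atTop.comp
    ((tendsto_inv_nhdsGT_zero.comp tendsto_sqrt).const_mul_atTop two_pos)

lemma four_le_window_sq_mul {Δ : ℝ} (hΔ : 0 < Δ) : 4 ≤ (window Δ : ℝ) ^ 2 * Δ :=
  calc (4 : ℝ) = (2 / √Δ) ^ 2 * Δ := by
        rw [div_pow, Real.sq_sqrt hΔ.le, div_mul_cancel₀ _ hΔ.ne']
        norm_num
    _ ≤ (window Δ : ℝ) ^ 2 * Δ := by
        gcongr
        exact Nat.le_ceil _

lemma window_le {Δ : ℝ} (hΔ : 0 < Δ) (hΔ₁ : Δ ≤ 1) : (window Δ : ℝ) ≤ 3 / √Δ := by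
  have one_le : 1 ≤ 1 / √Δ := (one_le_div (Real.sqrt_pos.2 hΔ)).2 (Real.sqrt_le_one.2 hΔ₁)
  calc (window Δ : ℝ) ≤ 2 / √Δ + 1 := (Nat.ceil_lt_add_one (by positivity)).le
    _ ≤ 2 / √Δ + 1 / √Δ := by gcongr
    _ = 3 / √Δ := by ring

lemma log_two_mul_window_le {Δ : ℝ} (hΔ : 0 < Δ) (hΔ₁ : Δ ≤ 1 / 36) :
    Real.log (2 * window Δ) ≤ |Real.log Δ| := by
  have window_pos : (0 : ℝ) < window Δ := by exact_mod_cast window_pos hΔ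
  have log_le : Real.log Δ ≤ -(2 * Real.log 6) := by
    rw [← Real.log_rpow (by norm_num), ← Real.log_inv]
    exact Real.log_le_log hΔ (hΔ₁.trans_eq (by norm_num))
  calc Real.log (2 * window Δ) ≤ Real.log (6 / √Δ) :=
        Real.log_le_log (by positivity) (by
          linarith [window_le hΔ (hΔ₁.trans (by norm_num)),
            (by ring : 2 * (3 / √Δ) = 6 / √Δ)])
    _ = Real.log 6 - Real.log Δ / 2 := by
        rw [Real.log_div (by norm_num) (Real.sqrt_pos.2 hΔ).ne', Real.log_sqrt hΔ.le]
    _ ≤ -Real.log Δ := by linarith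
    _ ≤ |Real.log Δ| := neg_le_abs _

lemma rpow_half_div_log_le_window {γ Δ : ℝ} (hγ : 0 ≤ γ) (hΔ : 0 < Δ) (hΔ₁ : Δ ≤ 1 / 36) :
    (3 ^ γ)⁻¹ * (Δ ^ (γ / 2) / |Real.log Δ|) ≤
      (window Δ : ℝ) ^ (-γ) / Real.log (2 * window Δ) := by
  have one_le_window : (1 : ℝ) ≤ window Δ := by exact_mod_cast window_pos hΔ
  have rpow_le : (3 ^ γ)⁻¹ * Δ ^ (γ / 2) ≤ (window Δ : ℝ) ^ (-γ) :=
    calc (3 ^ γ)⁻¹ * Δ ^ (γ / 2) = (3 / √Δ) ^ (-γ) := by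
          rw [Real.rpow_neg (by positivity), Real.div_rpow (by norm_num) (Real.sqrt_nonneg Δ),
            inv_div, Real.sqrt_eq_rpow, ← Real.rpow_mul hΔ.le, one_div_mul_eq_div,
            inv_mul_eq_div]
      _ ≤ (window Δ : ℝ) ^ (-γ) :=
          Real.rpow_le_rpow_of_nonpos (by positivity)
            (window_le hΔ (hΔ₁.trans (by norm_num))) (by linarith)
  have log_pos : 0 < Real.log (2 * window Δ) := Real.log_pos (by linarith)
  rw [← mul_div_assoc]
  exact div_le_div₀ (by positivity) rpow_le log_pos (log_two_mul_window_le hΔ hΔ₁)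

lemma eventually_const_mul_log_two_mul_le_rpow {δ : ℝ} (hδ : 0 < δ) (c : ℝ) :
    ∀ᶠ K : ℕ in atTop, c * Real.log (2 * K) ≤ (K : ℝ) ^ δ := by
  have tendsto_two_mul : Tendsto (fun K : ℕ => 2 * (K : ℝ)) atTop atTop :=
    tendsto_natCast_atTop_atTop.const_mul_atTop two_pos
  have log_isLittleO := (isLittleO_log_rpow_atTop hδ).comp_tendsto tendsto_two_mul
  have tendsto_zero := (log_isLittleO.tendsto_div_nhds_zero.const_mul (c * 2 ^ δ))
  rw [mul_zero] at tendsto_zero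
  filter_upwards [tendsto_zero.eventually_le_const one_pos, eventually_gt_atTop 0] with K hle hK
  have hK : (0 : ℝ) < K := by exact_mod_cast hK
  simp only [Function.comp_apply, Real.mul_rpow two_pos.le hK.le] at hle
  rw [← div_le_one (Real.rpow_pos_of_pos hK δ)]
  convert hle using 1
  field_simp

lemma eventually_rpow_neg_div_log_le {γ ι : ℝ} (hι : γ / 2 - 1 / 4 < ι) (M : ℝ) :
    ∀ᶠ K : ℕ in atTop, (K : ℝ) ^ (-γ) / (2 ^ (γ + 5 / 2) * Real.log (2 * K)) ≤
      (K * (1 / ((2 * K : ℝ) ^ (γ + 1 / 2) * Real.log (2 * K)) / 2) -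
        M * (K : ℝ) ^ (-(2 * ι))) / √K := by
  filter_upwards [eventually_const_mul_log_two_mul_le_rpow
    (by linarith : 0 < 2 * ι + 1 / 2 - γ) (M * 2 ^ (γ + 5 / 2)), eventually_gt_atTop 0]
    with K hM hK
  have one_le : (1 : ℝ) ≤ K := by exact_mod_cast hK
  have hK : (0 : ℝ) < K := by exact_mod_cast hK
  have log_pos : 0 < Real.log (2 * K) := Real.log_pos (by linarith)
  set L := Real.log (2 * K)
  have noise_eq : K * (1 / ((2 * K : ℝ) ^ (γ + 1 / 2) * L) / 2) =
      2 * ((K : ℝ) ^ (-γ) * √K / (2 ^ (γ + 5 / 2) * L)) := by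
    rw [Real.mul_rpow two_pos.le hK.le, show γ + 5 / 2 = γ + 1 / 2 + 2 by ring,
      Real.rpow_add two_pos _ 2, Real.rpow_neg hK.le, Real.rpow_add hK, ← Real.sqrt_eq_rpow,
      Real.rpow_two]
    field_simp
    rw [Real.sq_sqrt hK.le]
  have initial_le : M * (K : ℝ) ^ (-(2 * ι)) ≤ (K : ℝ) ^ (-γ) * √K / (2 ^ (γ + 5 / 2) * L) := by
    rw [le_div_iff₀ (by positivity)]
    calc M * (K : ℝ) ^ (-(2 * ι)) * (2 ^ (γ + 5 / 2) * L)
        = M * 2 ^ (γ + 5 / 2) * L * (K : ℝ) ^ (-(2 * ι)) := by ring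
      _ ≤ (K : ℝ) ^ (2 * ι + 1 / 2 - γ) * (K : ℝ) ^ (-(2 * ι)) := by gcongr
      _ = (K : ℝ) ^ (-γ) * √K := by
          rw [Real.sqrt_eq_rpow, ← Real.rpow_add hK, ← Real.rpow_add hK]
          ring_nf
  rw [le_div_iff₀ (Real.sqrt_pos.2 hK), noise_eq, div_mul_eq_mul_div]
  linarith

lemma eventually_rpow_half_div_log_le_window {γ ι : ℝ} (hγ : 0 ≤ γ) (hι : γ / 2 - 1 / 4 < ι)
    (M : ℝ) :
    ∀ᶠ Δ : ℝ in 𝓝[>] 0, (2 ^ (γ + 5 / 2))⁻¹ * (3 ^ γ)⁻¹ * (Δ ^ (γ / 2) / |Real.log Δ|) ≤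
      (window Δ * (1 / ((2 * window Δ : ℝ) ^ (γ + 1 / 2) * Real.log (2 * window Δ)) / 2) -
        M * (window Δ : ℝ) ^ (-(2 * ι))) / √(window Δ) := by
  filter_upwards [tendsto_window.eventually (eventually_rpow_neg_div_log_le hι M),
    self_mem_nhdsWithin, nhdsWithin_le_nhds (Iic_mem_nhds (by norm_num : (0 : ℝ) < 1 / 36))]
    with Δ window_le hΔ hΔ₁
  calc (2 ^ (γ + 5 / 2))⁻¹ * (3 ^ γ)⁻¹ * (Δ ^ (γ / 2) / |Real.log Δ|)
      ≤ (2 ^ (γ + 5 / 2))⁻¹ * ((window Δ : ℝ) ^ (-γ) / Real.log (2 * window Δ)) := by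
        rw [mul_assoc]
        gcongr
        exact rpow_half_div_log_le_window hγ hΔ hΔ₁
    _ = (window Δ : ℝ) ^ (-γ) / (2 ^ (γ + 5 / 2) * Real.log (2 * window Δ)) := by ring
    _ ≤ _ := window_le

end Window

section LowerBound

lemma sum_Ico_le_mul_rpow_neg {m : ℕ → ℝ} (hm : ∀ j, 0 ≤ m j) {ι M : ℝ} (hι : 0 ≤ ι) {K : ℕ}
    (hK : 0 < K) (hM : ∑ j ∈ Finset.Ico K (2 * K), (((j : ℝ) + 1) ^ 2) ^ ι * m j ≤ M) :
    ∑ j ∈ Finset.Ico K (2 * K), m j ≤ M * (K : ℝ) ^ (-(2 * ι)) := by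
  have hK : (0 : ℝ) < K := by exact_mod_cast hK
  rw [Real.rpow_neg hK.le, ← div_eq_mul_inv, le_div_iff₀ (Real.rpow_pos_of_pos hK _), mul_comm,
    Finset.mul_sum]
  refine (Finset.sum_le_sum fun j hj => mul_le_mul_of_nonneg_right ?_ (hm j)).trans hM
  have hKj : (K : ℝ) ≤ j := by exact_mod_cast (Finset.mem_Ico.1 hj).1
  rw [Real.rpow_mul hK.le, Real.rpow_two]
  gcongr
  linarith

variable {H : Type*} [NormedAddCommGroup H] [InnerProductSpace ℝ H] [CompleteSpace H]
variable {Ω : Type*} {mΩ : MeasurableSpace Ω} {P : Measure Ω}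
variable {W X : ℝ≥0 → Ω → H} {X₀ : Ω → H} {Q : H →L[ℝ] H} {ℱ : Filtration ℝ≥0 mΩ}
variable {e : HilbertBasis ℕ ℝ H} {γ ι : ℝ} {T : ℝ≥0}

namespace IsMildSolution

lemma le_neg_sum_inner_bias (hX : IsMildSolution (diagOp e fun j => ((j : ℝ) + 1) ^ 2) Q W X₀ X P)
    (hW : IsQWiener W Q ℱ P) (hX₀ : StronglyMeasurable[ℱ 0] X₀) (hX₀₂ : MemLp X₀ 2 P)
    (hQ : IsDiagonal e (noiseEigenvalue γ) Q) (hγ : 0 ≤ γ) (hT : 0 < T) {Δ : ℝ≥0} {K : ℕ}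
    (hK : 4 ≤ (K : ℝ) ^ 2 * Δ) :
    K * (1 / ((2 * K : ℝ) ^ (γ + 1 / 2) * Real.log (2 * K)) / 2) -
        (T : ℝ)⁻¹ * ∑ j ∈ Finset.Ico K (2 * K), ∫ ω, ⟪e j, X₀ ω⟫ ^ 2 ∂P ≤
      -∑ j ∈ Finset.Ico K (2 * K), ⟪e j, bias X Q T Δ P (e j)⟫ := by
  set a := 1 / ((2 * K : ℝ) ^ (γ + 1 / 2) * Real.log (2 * K))
  have inner_Q (j : ℕ) : ⟪Q (e j), e j⟫ = noiseEigenvalue γ j := by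
    rw [hQ.apply_basis, real_inner_smul_left, real_inner_self_eq_norm_sq, e.orthonormal.1 j,
      one_pow, mul_one]
  have term_le : ∀ j ∈ Finset.Ico K (2 * K), a / 2 - (T : ℝ)⁻¹ * ∫ ω, ⟪e j, X₀ ω⟫ ^ 2 ∂P ≤
      -⟪e j, bias X Q T Δ P (e j)⟫ := by
    intro j hj
    have hKj : (K : ℝ) ≤ j := by exact_mod_cast (Finset.mem_Ico.1 hj).1
    have two_le : 2 ≤ ((j : ℝ) + 1) ^ 2 * Δ := by
      have : (K : ℝ) ^ 2 * Δ ≤ ((j : ℝ) + 1) ^ 2 * Δ := by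
        gcongr
        linarith
      linarith
    have bias_le := hX.inner_bias_apply_le hW hX₀ hX₀₂ hT (k := j) (by positivity) two_le
      ((noiseEigenvalue_nonneg γ j).trans_eq (inner_Q j).symm)
    rw [inner_Q] at bias_le
    linarith [noiseEigenvalue_ge hγ hj]
  calc K * (a / 2) - (T : ℝ)⁻¹ * ∑ j ∈ Finset.Ico K (2 * K), ∫ ω, ⟪e j, X₀ ω⟫ ^ 2 ∂P
      = ∑ j ∈ Finset.Ico K (2 * K), (a / 2 - (T : ℝ)⁻¹ * ∫ ω, ⟪e j, X₀ ω⟫ ^ 2 ∂P) := by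
        rw [Finset.sum_sub_distrib, Finset.sum_const, Nat.card_Ico, two_mul, Nat.add_sub_cancel,
          nsmul_eq_mul, Finset.mul_sum]
    _ ≤ -∑ j ∈ Finset.Ico K (2 * K), ⟪e j, bias X Q T Δ P (e j)⟫ := by
        rw [← Finset.sum_neg_distrib]
        exact Finset.sum_le_sum term_le

variable [IsProbabilityMeasure P]

theorem eventually_le_hsNorm_bias
    (hX : IsMildSolution (diagOp e fun j => ((j : ℝ) + 1) ^ 2) Q W X₀ X P)
    (hW : IsQWiener W Q ℱ P)
    (hX₀ : InitialAssumption (diagOp e fun j => ((j : ℝ) + 1) ^ 2) X₀ ι ℱ P)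
    (hQ : IsDiagonal e (noiseEigenvalue γ) Q) (hγ : 1 / 2 < γ) (hι : γ / 2 - 1 / 4 < ι)
    (hT : 0 < T) :
    ∀ᶠ Δ : ℝ≥0 in 𝓝[>] 0,
      ENNReal.ofReal ((2 ^ (γ + 5 / 2))⁻¹ * (3 ^ γ)⁻¹ * ((Δ : ℝ) ^ (γ / 2) / |Real.log Δ|)) ≤
        hsNorm (bias X Q T Δ P) := by
  obtain ⟨M, sum_le_M⟩ := hX₀.exists_sum_rpow_mul_integral_inner_sq_le fun j => by positivity
  have tendsto_coe : Tendsto ((↑) : ℝ≥0 → ℝ) (𝓝[>] 0) (𝓝[>] 0) :=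
    NNReal.continuous_coe.continuousWithinAt.tendsto_nhdsWithin fun _ => id
  filter_upwards [self_mem_nhdsWithin, tendsto_coe.eventually
    (eventually_rpow_half_div_log_le_window (by linarith) hι ((T : ℝ)⁻¹ * M))]
    with Δ (hΔ : (0 : ℝ) < Δ) window_lower
  set K := window Δ
  set σ := ∑ j ∈ Finset.Ico K (2 * K), ⟪e j, bias X Q T Δ P (e j)⟫
  have le_abs_sum : K * (1 / ((2 * K : ℝ) ^ (γ + 1 / 2) * Real.log (2 * K)) / 2) -
      (T : ℝ)⁻¹ * M * (K : ℝ) ^ (-(2 * ι)) ≤ |σ| := by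
    have initial_le := sum_Ico_le_mul_rpow_neg (K := K)
      (fun j => integral_nonneg fun ω => sq_nonneg ⟪e j, X₀ ω⟫) (by linarith) (window_pos hΔ)
      (sum_le_M _)
    have := mul_le_mul_of_nonneg_left initial_le (inv_nonneg.2 T.coe_nonneg)
    linarith [neg_le_abs σ, hX.le_neg_sum_inner_bias hW hX₀.stronglyMeasurable hX₀.memLp_two hQ
      (by linarith) hT (four_le_window_sq_mul hΔ)]
  have card_eq : (Finset.Ico K (2 * K)).card = K := by
    rw [Nat.card_Ico, two_mul, Nat.add_sub_cancel]
  calc ENNReal.ofReal ((2 ^ (γ + 5 / 2))⁻¹ * (3 ^ γ)⁻¹ * ((Δ : ℝ) ^ (γ / 2) / |Real.log Δ|))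
      ≤ ENNReal.ofReal (|σ| / √(Finset.Ico K (2 * K)).card) := by
        rw [card_eq]
        exact ENNReal.ofReal_le_ofReal (window_lower.trans (by gcongr))
    _ ≤ hsNorm (bias X Q T Δ P) := ofReal_abs_sum_inner_div_sqrt_card_le_hsNorm e _ _

end IsMildSolution

end LowerBound

section Basis

lemma countable_of_hilbertBasis {ι H : Type*} [NormedAddCommGroup H] [InnerProductSpace ℝ H]
    [TopologicalSpace.SeparableSpace H] (b : HilbertBasis ι ℝ H) : Countable ι := by
  refine Pairwise.countable_of_isOpen_disjoint (s := fun i => Metric.ball (b i) (1 / 2))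
    (fun i j hij => Metric.ball_disjoint_ball ?_) (fun i => Metric.isOpen_ball)
    fun i => Metric.nonempty_ball.2 (by norm_num)
  have dist_sq : dist (b i) (b j) ^ 2 = 2 := by
    rw [dist_eq_norm, norm_sub_sq_real, b.orthonormal.1, b.orthonormal.1, b.orthonormal.2 hij]
    norm_num
  nlinarith [dist_nonneg (x := b i) (y := b j)]

lemma exists_hilbertBasis_nat {H : Type*} [NormedAddCommGroup H] [InnerProductSpace ℝ H]
    [CompleteSpace H] [TopologicalSpace.SeparableSpace H] (hinf : ¬ FiniteDimensional ℝ H) :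
    Nonempty (HilbertBasis ℕ ℝ H) := by
  obtain ⟨w, b, -⟩ := exists_hilbertBasis ℝ H
  have : Countable w := countable_of_hilbertBasis b
  have : Infinite w := by
    by_contra h
    have : Finite w := not_infinite_iff_finite.1 h
    have := Fintype.ofFinite w
    exact hinf b.toOrthonormalBasis.toBasis.finiteDimensional_of_finite
  obtain ⟨φ⟩ := nonempty_equiv_of_countable (α := ℕ) (β := w)
  refine ⟨HilbertBasis.mk (b.orthonormal.comp φ φ.injective) ?_⟩
  rw [φ.surjective.range_comp b, b.dense_span]

lemma exists_seq_isOpen_pairwise_disjoint_subset {E : Type*} [TopologicalSpace E] [T2Space E]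
    [∀ x : E, (𝓝[≠] x).NeBot] {V : Set E} (hV : IsOpen V) (hVne : V.Nonempty) :
    ∃ U : ℕ → Set E, (∀ n, IsOpen (U n)) ∧ (∀ n, (U n).Nonempty) ∧ (∀ n, U n ⊆ V) ∧
      Pairwise (Function.onFun Disjoint U) := by
  obtain ⟨x, hx⟩ := hVne
  have : Infinite V := (infinite_of_mem_nhds x (hV.mem_nhds hx)).to_subtype
  obtain ⟨U, hU_infinite, hU_open, hU_disjoint⟩ := exists_seq_infinite_isOpen_pairwise_disjoint V
  exact ⟨fun n => (↑) '' U n, fun n => hV.isOpenMap_subtype_val _ (hU_open n),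
    fun n => (hU_infinite n).nonempty.image _, fun n => Subtype.coe_image_subset V (U n),
    fun m n hmn => (Set.disjoint_image_iff Subtype.val_injective).2 (hU_disjoint hmn)⟩

lemma not_finiteDimensional_L2 {E : Type*} [MeasurableSpace E] {μ : Measure E} {U : ℕ → Set E}
    (hU : ∀ n, MeasurableSet (U n)) (hU_disjoint : Pairwise (Function.onFun Disjoint U))
    (hU_pos : ∀ n, μ (U n) ≠ 0) (hU_fin : ∀ n, μ (U n) ≠ ∞) :
    ¬ FiniteDimensional ℝ (Lp ℝ 2 μ) := by
  intro _
  have inner_eq (m n : ℕ) : ⟪indicatorConstLp 2 (hU m) (hU_fin m) (1 : ℝ),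
      indicatorConstLp 2 (hU n) (hU_fin n) (1 : ℝ)⟫ = μ.real (U m ∩ U n) :=
    L2.real_inner_indicatorConstLp_one_indicatorConstLp_one (hU m) (hU n) (hU_fin m) (hU_fin n)
  have linearIndependent : LinearIndependent ℝ
      fun n => indicatorConstLp 2 (hU n) (hU_fin n) (1 : ℝ) := by
    refine linearIndependent_of_ne_zero_of_inner_eq_zero (𝕜 := ℝ) (fun n hn => ?_)
      fun m n hmn => ?_
    · have inner_self := inner_eq n n
      rw [hn, inner_zero_left, Set.inter_self] at inner_self
      exact (ENNReal.toReal_pos (hU_pos n) (hU_fin n)).ne inner_self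
    · exact (inner_eq m n).trans (by rw [(hU_disjoint hmn).inter_eq, measureReal_empty])
  exact not_finite_iff_infinite.2 inferInstance linearIndependent.finite

lemma not_finiteDimensional_L2_restrict {E : Type*} [TopologicalSpace E] [T2Space E]
    [∀ x : E, (𝓝[≠] x).NeBot] [MeasurableSpace E] [OpensMeasurableSpace E] {μ : Measure E}
    [IsLocallyFiniteMeasure μ] [μ.IsOpenPosMeasure] {D : Set E} (hD : IsOpen D)
    (hDne : D.Nonempty) : ¬ FiniteDimensional ℝ (Lp ℝ 2 (μ.restrict D)) := by
  obtain ⟨x, hx⟩ := hDne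
  obtain ⟨V, hxV, hV, hμV⟩ := μ.exists_isOpen_measure_lt_top x
  obtain ⟨U, hU_open, hU_nonempty, hUV, hU_disjoint⟩ :=
    exists_seq_isOpen_pairwise_disjoint_subset (hV.inter hD) ⟨x, hxV, hx⟩
  have restrict_eq (n : ℕ) : μ.restrict D (U n) = μ (U n) :=
    Measure.restrict_eq_self μ ((hUV n).trans Set.inter_subset_right)
  refine not_finiteDimensional_L2 (fun n => (hU_open n).measurableSet) hU_disjoint
    (fun n => ?_) fun n => ?_
  · rw [restrict_eq]
    exact ((hU_open n).measure_pos μ (hU_nonempty n)).ne'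
  · rw [restrict_eq]
    exact measure_ne_top_of_subset ((hUV n).trans Set.inter_subset_left) hμV.ne

lemma exists_hilbertBasis_nat_L2_restrict {E : Type*} [TopologicalSpace E] [T2Space E]
    [∀ x : E, (𝓝[≠] x).NeBot] [MeasurableSpace E] [OpensMeasurableSpace E]
    [MeasurableSpace.CountablyGenerated E] {μ : Measure E} [SFinite μ] [IsLocallyFiniteMeasure μ]
    [μ.IsOpenPosMeasure] {D : Set E} (hD : IsOpen D) (hDne : D.Nonempty) :
    Nonempty (HilbertBasis ℕ ℝ (Lp ℝ 2 (μ.restrict D))) := by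
  have : Fact ((2 : ℝ≥0∞) ≠ ∞) := ⟨ENNReal.ofNat_ne_top⟩
  exact exists_hilbertBasis_nat (not_finiteDimensional_L2_restrict hD hDne)

end Basis

end RealizedCovariation

theorem proposition1_general {H : Type*} [NormedAddCommGroup H] [InnerProductSpace ℝ H]
    [CompleteSpace H] (e : HilbertBasis ℕ ℝ H) {γ : ℝ} (hγ : 1 / 2 < γ) :
    ∃ Q : H →L[ℝ] H, (∀ j, Q (e j) = noiseEigenvalue γ j • e j) ∧
      OperatorAssumption (diagOp e fun j => ((j : ℝ) + 1) ^ 2) Q γ ∧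
      ∃ C : ℝ, 0 < C ∧
        ∀ (T : ℝ≥0) (_ : 0 < T) (Ω : Type*) (mΩ : MeasurableSpace Ω) (P : Measure Ω)
          (_ : IsProbabilityMeasure P) (ℱ : Filtration ℝ≥0 mΩ) (W X : ℝ≥0 → Ω → H) (X₀ : Ω → H)
          (ι : ℝ), IsQWiener W Q ℱ P → γ / 2 - 1 / 4 < ι →
          InitialAssumption (diagOp e fun j => ((j : ℝ) + 1) ^ 2) X₀ ι ℱ P →
          IsMildSolution (diagOp e fun j => ((j : ℝ) + 1) ^ 2) Q W X₀ X P →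
          ∃ Δ₀ : ℝ≥0, 0 < Δ₀ ∧ ∀ Δ : ℝ≥0, 0 < Δ → Δ < Δ₀ →
            Integrable (realizedCovariation X T Δ) P ∧
            hsNorm ((∫ ω, (T : ℝ)⁻¹ • realizedCovariation X T Δ ω ∂P) - Q) ≤
              hsL2Norm (fun ω => (T : ℝ)⁻¹ • realizedCovariation X T Δ ω - Q) P ∧
            ENNReal.ofReal (C * ((Δ : ℝ) ^ (γ / 2) / |Real.log Δ|)) ≤
              hsNorm ((∫ ω, (T : ℝ)⁻¹ • realizedCovariation X T Δ ω ∂P) - Q) := by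
  have summable_noise := summable_noiseEigenvalue hγ
  have tendsto_eigenvalue : Tendsto (fun j : ℕ => ((j : ℝ) + 1) ^ 2) atTop atTop :=
    (tendsto_pow_atTop two_ne_zero).comp
      (tendsto_atTop_add_const_right _ _ tendsto_natCast_atTop_atTop)
  obtain ⟨Q, hQ⟩ := exists_isDiagonal (e := e) (c := noiseEigenvalue γ)
    summable_noise.tendsto_atTop_zero.abs.bddAbove_range
  refine ⟨Q, hQ.apply_basis, hQ.operatorAssumption (fun j => by positivity) tendsto_eigenvalue
    (noiseEigenvalue_nonneg γ) summable_noise (summable_weighted_noiseEigenvalue_sq γ),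
    (2 ^ (γ + 5 / 2))⁻¹ * (3 ^ γ)⁻¹, by positivity, ?_⟩
  intro T hT Ω mΩ P _ ℱ W X X₀ ι hW hι hX₀ hX
  obtain ⟨Δ₀, hΔ₀, lower_bound⟩ := mem_nhdsGT_iff_exists_Ioo_subset.1
    (hX.eventually_le_hsNorm_bias hW hX₀ hQ hγ hι hT)
  have memLp := hX.memLp hX₀.memLp_two
  exact ⟨Δ₀, hΔ₀, fun Δ hΔ hΔlt => ⟨integrable_realizedCovariation memLp T Δ,
    hsNorm_bias_le_hsL2Norm e memLp Q T Δ, lower_bound ⟨hΔ, hΔlt⟩⟩⟩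

theorem proposition1
    -- the state space `H = L²(D)`
    (d : ℕ) (hd : 1 ≤ d) (D : Set (EuclideanSpace ℝ (Fin d))) (hD : IsOpen D) (hDne : D.Nonempty)
    (γ : ℝ) (hγ : γ ∈ Set.Ioo (1 / 2 : ℝ) 1) (T : ℝ≥0) (hT : 0 < T) :
    ∃ (A : Lp ℝ 2 (volume.restrict D) →ₗ.[ℝ] Lp ℝ 2 (volume.restrict D))
      (Q : Lp ℝ 2 (volume.restrict D) →L[ℝ] Lp ℝ 2 (volume.restrict D)),
      -- `A` and `Q` are diagonal with eigenvalues `k²` and `1 / (k^{γ + 1/2} log k)`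
      (∃ e : HilbertBasis ℕ ℝ (Lp ℝ 2 (volume.restrict D)),
        A = diagOp e (fun j => ((j : ℝ) + 1) ^ 2) ∧ ∀ j, Q (e j) = noiseEigenvalue γ j • e j) ∧
      OperatorAssumption A Q γ ∧
      ∃ C : ℝ, 0 < C ∧
        ∀ (Ω : Type*) (mΩ : MeasurableSpace Ω) (P : Measure Ω) (_ : IsProbabilityMeasure P)
          (ℱ : Filtration ℝ≥0 mΩ) (W X : ℝ≥0 → Ω → Lp ℝ 2 (volume.restrict D))
          (X₀ : Ω → Lp ℝ 2 (volume.restrict D)) (ι : ℝ),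
          IsQWiener W Q ℱ P → γ / 2 ≤ ι → InitialAssumption A X₀ ι ℱ P →
          IsMildSolution A Q W X₀ X P →
          ∃ Δ₀ : ℝ≥0, 0 < Δ₀ ∧ ∀ Δ : ℝ≥0, 0 < Δ → Δ < Δ₀ →
            Integrable (realizedCovariation X T Δ) P ∧
            hsNorm ((∫ ω, (T : ℝ)⁻¹ • realizedCovariation X T Δ ω ∂P) - Q) ≤
              hsL2Norm (fun ω => (T : ℝ)⁻¹ • realizedCovariation X T Δ ω - Q) P ∧
            ENNReal.ofReal (C * ((Δ : ℝ) ^ (γ / 2) / |Real.log Δ|)) ≤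
              hsNorm ((∫ ω, (T : ℝ)⁻¹ • realizedCovariation X T Δ ω ∂P) - Q) := by
  have : Nonempty (Fin d) := ⟨⟨0, hd⟩⟩
  obtain ⟨e⟩ := exists_hilbertBasis_nat_L2_restrict (μ := volume) hD hDne
  obtain ⟨Q, hQ, hAQ, C, hC, lower_bound⟩ := proposition1_general e hγ.1
  exact ⟨_, Q, ⟨e, rfl, hQ⟩, hAQ, C, hC, fun Ω mΩ P hP ℱ W X X₀ ι hW hι =>
    lower_bound T hT Ω mΩ P hP ℱ W X X₀ ι hW (by linarith)⟩
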